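/- For $n\ge 1$ let $(\lambda_1,\dots,\lambda_n)$ be the eigenvalues of the Gaussian orthogonal ensemble (GOE), i.e. a random vector in $\mathbb R^n$ with density $$\frac1{G_n}\,e^{-\sum_{i=1}^n\lambda_i^2/2}\prod_{1\le i<j\le n}|\lambda_i-\lambda_j|$$ with respect to Lebesgue measure, where $G_n$ is the integral over $\mathbb R^n$ of $e^{-\sum_i\lambda_i^2/2}\prod_{i<j}|\lambda_i-\lambda_j|$. Let $\lambda_{(1)}\le\dots\le\lambda_{(n)}$ be the increasing rearrangement of $\lambda_1,\dots,\lambda_n$, and put $$\chi^{(n)}=\sum_{i=1}^{n-1}\delta_{n(\lambda_{(i+1)}-\lambda_{(i)})},\qquad \widetilde\chi^{(n,2)}=\sum_{i=1}^{n-2}\delta_{n(\lambda_{(i+2)}-\lambda_{(i)})},\qquad \widetilde\chi^{(n)}=\sum_{1\le i<j\le n}\delta_{n|\lambda_i-\lambda_j|}.$$ Then there are no successive small gaps, in the following sense. (1) For every real $c_0$ and every integer $n>2c_0^2+2$, with $A=(0,c_0)$ (empty if $c_0\le 0$), $$\mathbb P\bigl(\widetilde\chi^{(n,2)}(A)>0\bigr)\le\frac{c_0^4}{8n}.$$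 (2) For every bounded interval $A\subset[0,\infty)$, $\chi^{(n)}(A)-\widetilde\chi^{(n)}(A)\to0$ in probability as $n\to\infty$; that is, for every $\varepsilon>0$, $\mathbb P\bigl(|\chi^{(n)}(A)-\widetilde\chi^{(n)}(A)|\ge\varepsilon\bigr)\to0$. -/

import Mathlib

open MeasureTheory Filter Topology

noncomputable section

namespace GOE

/-- The unnormalised joint eigenvalue density of the Gaussian orthogonal ensemble,
`exp (-∑ λᵢ² / 2) * ∏_{i < j} |λᵢ - λⱼ|`. -/
def weight (n : ℕ) (x : Fin n → ℝ) : ℝ :=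
  Real.exp (-(∑ i, x i ^ 2 / 2)) *
    ∏ p : Fin n × Fin n with p.1 < p.2, |x p.1 - x p.2|

/-- The normalisation constant `G_n`, the integral of the weight over `ℝⁿ`. -/
def partitionFunction (n : ℕ) : ℝ :=
  ∫ x : Fin n → ℝ, weight n x

/-- The law on `ℝⁿ` of the (unordered) eigenvalues `(λ₁, …, λₙ)` of the GOE: the measure with
density `G_n⁻¹ * weight` with respect to Lebesgue measure. -/
def law (n : ℕ) : Measure (Fin n → ℝ) :=
  volume.withDensity fun x => ENNReal.ofReal ((partitionFunction n)⁻¹ * weight n x)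

/-- The increasing rearrangement `λ_(1) ≤ ⋯ ≤ λ_(n)` of `(λ₁, …, λₙ)` (indices start at `0`). -/
def ordered {n : ℕ} (x : Fin n → ℝ) : Fin n → ℝ :=
  x ∘ Tuple.sort x

/-- The point process `∑_{i=1}^{n-j} δ_{n (λ_(i+j) - λ_(i))}` of scaled `j`-th neighbour gaps. -/
def neighbourGaps (n j : ℕ) (x : Fin n → ℝ) : Measure ℝ :=
  ∑ p : Fin n × Fin n with (p.1 : ℕ) + j = (p.2 : ℕ),
    Measure.dirac ((n : ℝ) * (ordered x p.2 - ordered x p.1))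

/-- The point process `χ^{(n)} = ∑_{i=1}^{n-1} δ_{n (λ_(i+1) - λ_(i))}` of scaled gaps between
consecutive eigenvalues. -/
def gaps (n : ℕ) (x : Fin n → ℝ) : Measure ℝ :=
  neighbourGaps n 1 x

/-- The point process `∑_{i<j} δ_{n |λ_i - λ_j|}` of all pairwise scaled gaps. -/
def pairGaps (n : ℕ) (x : Fin n → ℝ) : Measure ℝ :=
  ∑ p : Fin n × Fin n with p.1 < p.2,
    Measure.dirac ((n : ℝ) * |x p.1 - x p.2|)

theorem weight_nonneg (n : ℕ) (x : Fin n → ℝ) : 0 ≤ weight n x :=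
  mul_nonneg (Real.exp_pos _).le (Finset.prod_nonneg fun _ _ => abs_nonneg _)

theorem continuous_weight (n : ℕ) : Continuous (weight n) := by
  unfold weight
  fun_prop

theorem integrable_factor (m : ℕ) :
    Integrable fun t : ℝ => Real.exp (-(t ^ 2 / 2)) * (1 + |t|) ^ m := by
  have h (k : ℕ) : Integrable fun t : ℝ => t ^ k * Real.exp (-(1 / 2) * t ^ 2) := by
    simpa using integrable_rpow_mul_exp_neg_mul_sq (b := 1 / 2) (by norm_num)
      (s := (k : ℝ)) (by linarith [(Nat.cast_nonneg k : (0 : ℝ) ≤ k)])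
  have h2 : Integrable fun t : ℝ =>
      ∑ k ∈ Finset.range (m + 1),
        ‖t ^ k * Real.exp (-(1 / 2) * t ^ 2)‖ * (m.choose k : ℝ) :=
    integrable_finsetSum _ fun k _ => (h k).norm.mul_const _
  refine h2.congr (Eventually.of_forall fun t => ?_)
  simp only [add_comm (1 : ℝ), add_pow, Finset.mul_sum, one_pow, mul_one]
  refine Finset.sum_congr rfl fun k _ => ?_
  have e : -(1 / 2) * t ^ 2 = -(t ^ 2 / 2) := by ring
  rw [e, norm_mul, norm_pow, Real.norm_eq_abs, Real.norm_of_nonneg (Real.exp_pos _).le]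
  ring

theorem integrable_weight (n : ℕ) : Integrable (weight n) := by
  have h : Integrable fun x : Fin n → ℝ =>
      ∏ i, (Real.exp (-(x i ^ 2 / 2)) * (1 + |x i|) ^ (2 * n)) :=
    Integrable.fintype_prod (f := fun (_ : Fin n) (t : ℝ) =>
      Real.exp (-(t ^ 2 / 2)) * (1 + |t|) ^ (2 * n)) fun _ => integrable_factor _
  refine h.mono' (continuous_weight n).aestronglyMeasurable (Eventually.of_forall fun x => ?_)
  rw [Real.norm_of_nonneg (weight_nonneg n x), Finset.prod_mul_distrib, ← Real.exp_sum,
    Finset.sum_neg_distrib, weight]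
  refine mul_le_mul_of_nonneg_left ?_ (Real.exp_pos _).le
  have h1 (t : ℝ) : 1 ≤ 1 + |t| := by linarith [abs_nonneg t]
  calc ∏ p : Fin n × Fin n with p.1 < p.2, |x p.1 - x p.2|
      ≤ ∏ p : Fin n × Fin n with p.1 < p.2, ((1 + |x p.1|) * (1 + |x p.2|)) := by
        refine Finset.prod_le_prod (fun _ _ => abs_nonneg _) fun p _ => ?_
        have := abs_sub (x p.1) (x p.2)
        nlinarith [abs_nonneg (x p.1), abs_nonneg (x p.2),
          mul_nonneg (abs_nonneg (x p.1)) (abs_nonneg (x p.2))]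
    _ ≤ ∏ p : Fin n × Fin n, ((1 + |x p.1|) * (1 + |x p.2|)) :=
        Finset.prod_le_prod_of_subset_of_one_le (Finset.filter_subset _ _)
          (fun p _ => by positivity)
          fun p _ _ => one_le_mul_of_one_le_of_one_le (h1 _) (h1 _)
    _ = ∏ i, (1 + |x i|) ^ (2 * n) := by
        rw [Fintype.prod_prod_type]
        simp only [Finset.prod_mul_distrib, Finset.prod_const, Finset.card_univ,
          Fintype.card_fin, Finset.prod_pow]
        ring

theorem partitionFunction_pos (n : ℕ) : 0 < partitionFunction n := by
  have h0 : weight n (fun i => (i : ℝ)) ≠ 0 := by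
    refine mul_ne_zero (Real.exp_pos _).ne' (Finset.prod_ne_zero_iff.2 fun p hp => ?_)
    rw [abs_ne_zero, sub_ne_zero]
    have hlt : p.1 < p.2 := by simpa using hp
    have hv : (p.1 : ℕ) ≠ (p.2 : ℕ) := fun e => hlt.ne (Fin.ext e)
    exact Nat.cast_injective.ne hv
  exact integral_pos_of_integrable_nonneg_nonzero (continuous_weight n) (integrable_weight n)
    (weight_nonneg n) h0

/-- The law of the GOE eigenvalues is a probability measure. -/
instance isProbabilityMeasure_law (n : ℕ) : IsProbabilityMeasure (law n) := by
  refine ⟨?_⟩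
  have hG := partitionFunction_pos n
  rw [law, withDensity_apply _ MeasurableSet.univ, Measure.restrict_univ,
    ← ofReal_integral_eq_lintegral_ofReal ((integrable_weight n).const_mul _)
      (Eventually.of_forall fun x => mul_nonneg (inv_nonneg.2 hG.le) (weight_nonneg n x)),
    integral_const_mul]
  change ENNReal.ofReal ((partitionFunction n)⁻¹ * partitionFunction n) = 1
  rw [inv_mul_cancel₀ hG.ne', ENNReal.ofReal_one]

end GOE

end

/-!
Both assertions reduce to a bound for the probability that three eigenvalues are close, and this
bound comes from two exact integration-by-parts identities for logarithmic gases at inverse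
temperature one; no closed form of the partition function is needed.

Write `w` for the weight of `m + 2` particles. As a function of `x 0`, the quotient
`w / (x 0 - x 1)` jumps at `x 1`, and the height of the jump is twice the weight of the gas in which
the particles `0` and `1` have merged into a particle of charge `2` (`integral_pairDerivative_one`).
After symmetrisation over the particles the integral of its derivative is a multiple of the
partition function: the interaction terms cancel by the identity
`1 / ((a - b) (a - c)) + 1 / ((b - c) (b - a)) + 1 / ((c - a) (c - b)) = 0`, and the confinement
contributes `-1/2`. So merging two particles divides the partition function by `4`
(`integral_mergedWeight`).

In the merged gas, with the charge `2` at `x 0`, let `S r = ∑ (x i - x 0) ^ (-r)`, the sum being over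
the other `m` particles. The vector field with components `1 / (x i - x 0)` on these particles and
`-(S 1) / 2` on the merged one has divergence `S 2 + (S 1) ^ 2 / 2 - m` relative to the weight
(`sum_pairDerivative_mergedCharge`), and there is no jump, because the weight vanishes to second
order. So the mean of `S 2` is at most `m` (`integral_mergedDensity_le`).

If the ordered eigenvalues `a ≤ b ≤ c` are consecutive and `c - a < δ`, then moving `a` and `b` to
their midpoint, where they become one particle of charge `2`, increases the weight up to the factor
`b - a`, because no eigenvalue lies strictly between them, and it leaves `c` within `δ` of the merged
particle, so that `1 ≤ δ ^ 2 * S 2` (`weight_le_of_mem_closeTriple`). Integrating over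
`b - a ∈ [0, δ)` gives probability at most `δ ^ 4 * m / 8` for each choice of the labels of `a` and
`b` (`law_closeTriple_le`); with `δ = c₀ / n` and fewer than `n ^ 2` choices this is the first
assertion. For the second one, the two processes agree on a set below `C`, up to coinciding
eigenvalues, unless some second-neighbour gap lies in `(0, C)` (`gaps_eq_pairGaps`).
-/

namespace GOE

/-! ### Gaussian integrals of products of absolute differences -/

/-- A product of powers of absolute values, divided by some of its factors, is bounded by the
product of the bounds of all factors, provided these bounds are at least `1`. -/
theorem prod_abs_pow_mul_inv_pow_le {ι : Type*} (s : Finset ι) (u B : ι → ℝ) (e d : ι → ℕ)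
    (hB : ∀ k ∈ s, 1 ≤ B k) (hu : ∀ k ∈ s, |u k| ≤ B k) (hd : ∀ k ∈ s, d k ≤ e k) :
    (∏ k ∈ s, |u k| ^ e k) * ∏ k ∈ s, (|u k|⁻¹) ^ d k ≤ ∏ k ∈ s, B k ^ e k := by
  rw [← Finset.prod_mul_distrib]
  refine Finset.prod_le_prod (fun k _ => by positivity) fun k hk => ?_
  have hB1 := hB k hk
  rcases eq_or_ne (u k) 0 with h | h
  · have h1 : |u k| ^ e k ≤ 1 := pow_le_one₀ (abs_nonneg _) (by simp [h])
    have h2 : (|u k|⁻¹) ^ d k ≤ 1 := pow_le_one₀ (by positivity) (by simp [h])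
    calc |u k| ^ e k * (|u k|⁻¹) ^ d k ≤ 1 * 1 :=
          mul_le_mul h1 h2 (by positivity) zero_le_one
      _ ≤ B k ^ e k := by rw [one_mul]; exact one_le_pow₀ hB1
  · have h0 : |u k| ≠ 0 := abs_ne_zero.2 h
    rw [inv_pow, ← pow_sub₀ _ h0 (hd k hk)]
    calc |u k| ^ (e k - d k) ≤ B k ^ (e k - d k) := pow_le_pow_left₀ (abs_nonneg _) (hu k hk) _
      _ ≤ B k ^ e k := pow_le_pow_right₀ hB1 (Nat.sub_le _ _)

theorem abs_sub_le_one_add_mul (a b : ℝ) : |a - b| ≤ (1 + |a|) * (1 + |b|) := by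
  have := abs_sub a b
  nlinarith [mul_nonneg (abs_nonneg a) (abs_nonneg b)]

theorem one_le_one_add_mul (a b : ℝ) : 1 ≤ (1 + |a|) * (1 + |b|) := by
  nlinarith [mul_nonneg (abs_nonneg a) (abs_nonneg b), abs_nonneg a, abs_nonneg b]

/-- The weight of one particle of charge `β` in the field of particles at `c k`, as a function of
its position. -/
noncomputable def profile {ι : Type*} (s : Finset ι) (c : ι → ℝ) (e : ι → ℕ) (β : ℝ) (t : ℝ) : ℝ :=
  Real.exp (-(β * t ^ 2 / 2)) * ∏ k ∈ s, |t - c k| ^ e k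

/-- The logarithmic derivative of `profile`, away from the points `c k`. -/
noncomputable def profileForce {ι : Type*} (s : Finset ι) (c : ι → ℝ) (e : ι → ℕ) (β : ℝ) (t : ℝ) : ℝ :=
  ∑ k ∈ s, (e k : ℝ) * (t - c k)⁻¹ - β * t

section Profile

variable {ι : Type*} (s : Finset ι) (c : ι → ℝ) (e : ι → ℕ) (β : ℝ)

theorem profile_nonneg (t : ℝ) : 0 ≤ profile s c e β t := by
  unfold profile; positivity

theorem continuous_profile : Continuous (profile s c e β) := by
  unfold profile; fun_prop

theorem hasDerivAt_profile (t : ℝ) (ht : ∀ k ∈ s, t ≠ c k) :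
    HasDerivAt (profile s c e β) (profile s c e β t * profileForce s c e β t) t := by
  classical
  have h1 : HasDerivAt (fun t : ℝ => Real.exp (-(β * t ^ 2 / 2)))
      (Real.exp (-(β * t ^ 2 / 2)) * (-(β * t))) t := by
    have : HasDerivAt (fun t : ℝ => -(β * t ^ 2 / 2)) (-(β * t)) t := by
      have := (((hasDerivAt_id t).pow 2).const_mul β).div_const 2 |>.neg
      refine this.congr_deriv ?_
      simp; ring
    exact this.exp
  have h2 : HasDerivAt (fun t : ℝ => ∏ k ∈ s, |t - c k| ^ e k)
      ((∏ k ∈ s, |t - c k| ^ e k) * ∑ k ∈ s, (e k : ℝ) * (t - c k)⁻¹) t := by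
    have h3 (k : ι) (hk : k ∈ s) : HasDerivAt (fun t : ℝ => |t - c k| ^ e k)
        (|t - c k| ^ e k * ((e k : ℝ) * (t - c k)⁻¹)) t := by
      have h0 : t - c k ≠ 0 := sub_ne_zero.2 (ht k hk)
      have ha : HasDerivAt (fun t : ℝ => |t - c k|) (SignType.sign (t - c k) : ℝ) t := by
        simpa [Function.comp_def] using
          (hasDerivAt_abs h0).comp t ((hasDerivAt_id t).sub_const (c k))
      refine (ha.pow (e k)).congr_deriv ?_
      rcases Nat.eq_zero_or_pos (e k) with h | h
      · simp [h]
      · obtain ⟨m, hm⟩ := Nat.exists_eq_succ_of_ne_zero h.ne'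
        rw [hm]
        simp only [Nat.succ_eq_add_one, Nat.add_sub_cancel, pow_succ]
        have : (SignType.sign (t - c k) : ℝ) = |t - c k| * (t - c k)⁻¹ := by
          rw [eq_mul_inv_iff_mul_eq₀ h0, sign_mul_self]
        rw [this]; ring
    refine (HasDerivAt.fun_finsetProd h3).congr_deriv ?_
    rw [Finset.mul_sum]
    refine Finset.sum_congr rfl fun k hk => ?_
    rw [← Finset.mul_prod_erase s _ hk, smul_eq_mul]; ring
  refine (h1.mul h2).congr_deriv ?_
  unfold profile profileForce; ring

theorem exists_profile_bound (hβ : 1 ≤ β) : ∃ (C : ℝ) (N : ℕ), 0 ≤ C ∧ ∀ t,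
    |profile s c e β t| ≤ C * (Real.exp (-(t ^ 2 / 2)) * (1 + |t|) ^ N) ∧
    |profile s c e β t * profileForce s c e β t| ≤
      C * (Real.exp (-(t ^ 2 / 2)) * (1 + |t|) ^ N) := by
  classical
  set K : ℝ := ∏ k ∈ s, (1 + |c k|) ^ e k
  have hK : 0 ≤ K := Finset.prod_nonneg fun k _ => by positivity
  set A : ℝ := ∑ k ∈ s, (e k : ℝ) + β
  have hA0 : (0 : ℝ) ≤ ∑ k ∈ s, (e k : ℝ) := Finset.sum_nonneg fun k _ => by positivity
  have hA : 1 ≤ A := by simp only [A]; linarith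
  refine ⟨K * A, ∑ k ∈ s, e k + 1, by positivity, fun t => ?_⟩
  have hT : 1 ≤ 1 + |t| := by linarith [abs_nonneg t]
  have hE : Real.exp (-(β * t ^ 2 / 2)) ≤ Real.exp (-(t ^ 2 / 2)) :=
    Real.exp_le_exp.2 (by nlinarith [sq_nonneg t])
  have hprod : ∏ k ∈ s, ((1 + |t|) * (1 + |c k|)) ^ e k = (1 + |t|) ^ (∑ k ∈ s, e k) * K := by
    simp only [mul_pow, Finset.prod_mul_distrib, Finset.prod_pow_eq_pow_sum, K]
  have hb (d : ι → ℕ) (hd : ∀ k ∈ s, d k ≤ e k) :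
      (∏ k ∈ s, |t - c k| ^ e k) * ∏ k ∈ s, (|t - c k|⁻¹) ^ d k ≤
        (1 + |t|) ^ (∑ k ∈ s, e k) * K :=
    hprod ▸ prod_abs_pow_mul_inv_pow_le s _ _ e d (fun k _ => one_le_one_add_mul t (c k))
      (fun k _ => abs_sub_le_one_add_mul t (c k)) hd
  have hP : ∏ k ∈ s, |t - c k| ^ e k ≤ (1 + |t|) ^ (∑ k ∈ s, e k) * K := by
    simpa using hb 0 (fun _ _ => Nat.zero_le _)
  have hR : profile s c e β t ≤ Real.exp (-(t ^ 2 / 2)) * ((1 + |t|) ^ (∑ k ∈ s, e k) * K) :=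
    mul_le_mul hE hP (by positivity) (by positivity)
  have hRk (k : ι) (hk : k ∈ s) : (e k : ℝ) * (profile s c e β t * |t - c k|⁻¹) ≤
      (e k : ℝ) * (Real.exp (-(t ^ 2 / 2)) * ((1 + |t|) ^ (∑ k ∈ s, e k) * K)) := by
    rcases Nat.eq_zero_or_pos (e k) with h | h
    · simp [h]
    refine mul_le_mul_of_nonneg_left ?_ (by positivity)
    have := hb (fun l => if l = k then 1 else 0) (fun l _ => by split_ifs with hl <;> simp [hl]; omega)
    simp only [pow_ite, pow_one, pow_zero, Finset.prod_ite_eq', if_pos hk] at this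
    unfold profile
    rw [mul_assoc]
    exact mul_le_mul hE this (by positivity) (by positivity)
  have e1 : K * A * (Real.exp (-(t ^ 2 / 2)) * (1 + |t|) ^ (∑ k ∈ s, e k + 1)) =
      Real.exp (-(t ^ 2 / 2)) * ((1 + |t|) ^ (∑ k ∈ s, e k) * K) * (A * (1 + |t|)) := by ring
  set Z : ℝ := Real.exp (-(t ^ 2 / 2)) * ((1 + |t|) ^ (∑ k ∈ s, e k) * K)
  have hZ : 0 ≤ Z := by positivity
  have hR0 := profile_nonneg s c e β t
  rw [e1]
  constructor
  · rw [abs_of_nonneg hR0]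
    exact hR.trans (le_mul_of_one_le_right hZ (by nlinarith))
  · rw [abs_mul, abs_of_nonneg hR0]
    calc profile s c e β t * |profileForce s c e β t|
        ≤ profile s c e β t * (∑ k ∈ s, (e k : ℝ) * |t - c k|⁻¹ + β * |t|) := by
          refine mul_le_mul_of_nonneg_left ?_ hR0
          refine (abs_sub _ _).trans (add_le_add ?_ ?_)
          · refine (Finset.abs_sum_le_sum_abs _ _).trans_eq (Finset.sum_congr rfl fun k _ => ?_)
            rw [abs_mul, abs_inv, Nat.abs_cast]
          · rw [abs_mul, abs_of_nonneg (by linarith)]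
      _ = ∑ k ∈ s, (e k : ℝ) * (profile s c e β t * |t - c k|⁻¹) +
            profile s c e β t * (β * |t|) := by
          rw [mul_add, Finset.mul_sum]
          congr 1
          exact Finset.sum_congr rfl fun k _ => by ring
      _ ≤ ∑ k ∈ s, (e k : ℝ) * Z + Z * (β * |t|) :=
          add_le_add (Finset.sum_le_sum hRk)
            (mul_le_mul_of_nonneg_right hR (mul_nonneg (by linarith) (abs_nonneg t)))
      _ ≤ Z * (A * (1 + |t|)) := by
          rw [← Finset.sum_mul]
          have : Z * (A * (1 + |t|)) = (∑ k ∈ s, (e k : ℝ)) * Z + Z * (β * |t|) +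
            Z * ((∑ k ∈ s, (e k : ℝ)) * |t| + β) := by simp only [A]; ring
          rw [this]
          have : 0 ≤ Z * ((∑ k ∈ s, (e k : ℝ)) * |t| + β) := by
            refine mul_nonneg hZ (add_nonneg (mul_nonneg hA0 (abs_nonneg t)) (by linarith))
          linarith

theorem tendsto_exp_mul_one_add_abs_pow (N : ℕ) :
    Tendsto (fun t : ℝ => Real.exp (-(t ^ 2 / 2)) * (1 + |t|) ^ N) (cocompact ℝ) (𝓝 0) := by
  have h (s : ℝ) := tendsto_rpow_abs_mul_exp_neg_mul_sq_cocompact (a := 1 / 2) (by norm_num) s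
  have h2 := ((h 0).add (h N)).const_mul ((2 : ℝ) ^ (N - 1))
  rw [add_zero, mul_zero] at h2
  refine squeeze_zero (fun t => by positivity) (fun t => ?_) h2
  have e : -(1 / 2) * t ^ 2 = -(t ^ 2 / 2) := by ring
  rw [e, Real.rpow_zero, Real.rpow_natCast]
  have := add_pow_le (zero_le_one (α := ℝ)) (abs_nonneg t) N
  rw [one_pow] at this
  calc _ ≤ Real.exp (-(t ^ 2 / 2)) * (2 ^ (N - 1) * (1 + |t| ^ N)) := by gcongr
    _ = _ := by ring

theorem integrable_profile_mul_force (hβ : 1 ≤ β) :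
    Integrable fun t => profile s c e β t * profileForce s c e β t := by
  obtain ⟨C, N, hC, h⟩ := exists_profile_bound s c e β hβ
  refine ((integrable_factor N).const_mul C).mono' ?_ (Eventually.of_forall fun t => (h t).2)
  refine Measurable.aestronglyMeasurable ?_
  refine (continuous_profile s c e β).measurable.mul ?_
  unfold profileForce
  fun_prop

theorem tendsto_profile (hβ : 1 ≤ β) : Tendsto (profile s c e β) (cocompact ℝ) (𝓝 0) := by
  obtain ⟨C, N, hC, h⟩ := exists_profile_bound s c e β hβ
  refine squeeze_zero_norm (fun t => (h t).1) ?_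
  simpa using (tendsto_exp_mul_one_add_abs_pow N).const_mul C

theorem intervalIntegral_profile_mul_force (hβ : 1 ≤ β) (a b : ℝ) :
    ∫ t in a..b, profile s c e β t * profileForce s c e β t =
      profile s c e β b - profile s c e β a := by
  classical
  refine integral_eq_of_hasDerivAt_off_countable (s := ((s.image c : Finset ℝ) : Set ℝ)) _ _
    (Finset.countable_toSet _) (continuous_profile s c e β).continuousOn (fun t ht => ?_)
    (integrable_profile_mul_force s c e β hβ).intervalIntegrable
  refine hasDerivAt_profile s c e β t fun k hk h => ht.2 ?_
  simp only [Finset.coe_image, Set.mem_image, Finset.mem_coe]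
  exact ⟨k, hk, h.symm⟩

/-- Integrating the derivative of `profile` over the two half-lines with opposite signs leaves
only the boundary terms at `b`. -/
theorem integral_sign_mul_profile_mul_force (hβ : 1 ≤ β) (b : ℝ) :
    ∫ t, (SignType.sign (t - b) : ℝ) * (profile s c e β t * profileForce s c e β t) =
      -2 * profile s c e β b := by
  have hi := integrable_profile_mul_force s c e β hβ
  have h0 := tendsto_profile s c e β hβ
  have hI : ∫ t in Set.Ioi b, profile s c e β t * profileForce s c e β t =
      - profile s c e β b := by
    have h1 := intervalIntegral_tendsto_integral_Ioi b hi.integrableOn tendsto_id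
    simp only [intervalIntegral_profile_mul_force s c e β hβ, id] at h1
    refine tendsto_nhds_unique h1 ?_
    simpa using (h0.mono_left atTop_le_cocompact).sub_const (profile s c e β b)
  have hJ : ∫ t in Set.Iic b, profile s c e β t * profileForce s c e β t =
      profile s c e β b := by
    have h1 := intervalIntegral_tendsto_integral_Iic b hi.integrableOn tendsto_id
    simp only [intervalIntegral_profile_mul_force s c e β hβ, id] at h1
    refine tendsto_nhds_unique h1 ?_
    simpa using (h0.mono_left atBot_le_cocompact).const_sub (profile s c e β b)
  have hs : Integrable fun t =>
      (SignType.sign (t - b) : ℝ) * (profile s c e β t * profileForce s c e β t) := by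
    refine hi.mono ?_ (Eventually.of_forall fun t => ?_)
    · refine Measurable.aestronglyMeasurable ?_
      refine Measurable.mul ?_ ?_
      · have h : (fun t : ℝ => (SignType.sign (t - b) : ℝ)) = fun t =>
            if 0 < t - b then 1 else if t - b < 0 then -1 else 0 := by
          funext t
          rw [sign_apply]
          split_ifs <;> simp
        rw [h]
        exact Measurable.ite (measurableSet_lt (by fun_prop) (by fun_prop)) (by fun_prop)
          (Measurable.ite (measurableSet_lt (by fun_prop) (by fun_prop)) (by fun_prop)
            (by fun_prop))
      · refine (continuous_profile s c e β).measurable.mul ?_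
        unfold profileForce
        fun_prop
    · rw [norm_mul]
      refine mul_le_of_le_one_left (norm_nonneg _) ?_
      cases SignType.sign (t - b) <;> simp
  rw [← integral_add_compl measurableSet_Iic hs, Set.compl_Iic (a := b),
    setIntegral_congr_fun (g := fun t => profile s c e β t * profileForce s c e β t)
      measurableSet_Ioi (fun t ht => by
        simp only [sign_pos (sub_pos.2 (Set.mem_Ioi.1 ht)), SignType.coe_one, one_mul]), hI]
  rw [integral_Iic_eq_integral_Iio,
    setIntegral_congr_fun (g := fun t => -(profile s c e β t * profileForce s c e β t))
      measurableSet_Iio (fun t ht => by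
        simp only [sign_neg (sub_neg.2 (Set.mem_Iio.1 ht)), SignType.coe_neg, SignType.coe_one, neg_one_mul]),
    integral_neg, ← integral_Iic_eq_integral_Iio, hJ]
  ring

end Profile

/-! ### Particles of several charges -/

/-- The unnormalised density of a logarithmic gas in which particle `i` has charge `q i`: two
particles repel each other with exponent the product of their charges, and the Gaussian
confinement is proportional to the charge. All charges equal to `1` gives `weight`. -/
noncomputable def chargedWeight {n : ℕ} (q : Fin n → ℕ) (x : Fin n → ℝ) : ℝ :=
  Real.exp (-(∑ i, q i * x i ^ 2 / 2)) *
    ∏ p : Fin n × Fin n with p.1 < p.2, |x p.1 - x p.2| ^ (q p.1 * q p.2)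

/-- The factors of `chargedWeight` that do not involve particle `i`. -/
noncomputable def chargedRest {n : ℕ} (q : Fin n → ℕ) (i : Fin n) (x : Fin n → ℝ) : ℝ :=
  Real.exp (-(∑ k ∈ Finset.univ.erase i, q k * x k ^ 2 / 2)) *
    ∏ p : Fin n × Fin n with p.1 < p.2 ∧ p.1 ≠ i ∧ p.2 ≠ i, |x p.1 - x p.2| ^ (q p.1 * q p.2)

section Charged

variable {n : ℕ} (q : Fin n → ℕ)

theorem weight_eq_chargedWeight (x : Fin n → ℝ) : weight n x = chargedWeight 1 x := by
  simp [weight, chargedWeight]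

theorem chargedWeight_nonneg (x : Fin n → ℝ) : 0 ≤ chargedWeight q x :=
  mul_nonneg (Real.exp_pos _).le (Finset.prod_nonneg fun _ _ => by positivity)

theorem continuous_chargedWeight : Continuous (chargedWeight q) := by
  unfold chargedWeight; fun_prop

theorem chargedRest_nonneg (i : Fin n) (x : Fin n → ℝ) : 0 ≤ chargedRest q i x :=
  mul_nonneg (Real.exp_pos _).le (Finset.prod_nonneg fun _ _ => by positivity)

theorem chargedWeight_eq_zero_of_eq (hq : ∀ i, 1 ≤ q i) {x : Fin n → ℝ} {i j : Fin n}
    (hij : i ≠ j) (h : x i = x j) : chargedWeight q x = 0 := by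
  refine mul_eq_zero_of_right _ ?_
  have hp (a b : Fin n) : q a * q b ≠ 0 := by
    have := hq a; have := hq b; positivity
  rcases lt_or_gt_of_ne hij with hlt | hlt
  · refine Finset.prod_eq_zero (i := (i, j)) (by simpa using hlt) ?_
    simp [h, hp]
  · refine Finset.prod_eq_zero (i := (j, i)) (by simpa using hlt) ?_
    simp [h, hp]

/-- The pairs containing `i` correspond to the other particle of the pair. -/
theorem prod_pairs_with {M : Type*} [CommMonoid M] (f : Fin n → Fin n → M)
    (hf : ∀ a b, f a b = f b a) (i : Fin n) :
    ∏ p : Fin n × Fin n with p.1 < p.2, f p.1 p.2 =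
      (∏ k ∈ Finset.univ.erase i, f i k) *
        ∏ p : Fin n × Fin n with p.1 < p.2 ∧ p.1 ≠ i ∧ p.2 ≠ i, f p.1 p.2 := by
  rw [← Finset.prod_filter_mul_prod_filter_not _ (fun p : Fin n × Fin n => p.1 = i ∨ p.2 = i),
    Finset.filter_filter, Finset.filter_filter]
  congr 1
  · refine Finset.prod_nbij' (fun p => if p.1 = i then p.2 else p.1)
      (fun k => if i < k then (i, k) else (k, i)) ?_ ?_ ?_ ?_ ?_
    · rintro ⟨a, b⟩ h
      simp only [Finset.mem_filter, Finset.mem_univ, true_and, Finset.mem_erase, and_true] at h ⊢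
      split_ifs <;> grind
    · intro k hk
      simp only [Finset.mem_filter, Finset.mem_univ, true_and, Finset.mem_erase, and_true] at hk ⊢
      split_ifs <;> grind
    · rintro ⟨a, b⟩ h
      simp only [Finset.mem_filter, Finset.mem_univ, true_and] at h ⊢
      split_ifs <;> grind
    · intro k hk
      simp only [Finset.mem_erase] at hk ⊢
      split_ifs <;> grind
    · rintro ⟨a, b⟩ h
      simp only [Finset.mem_filter, Finset.mem_univ, true_and] at h ⊢
      split_ifs with h1
      · rw [h1]
      · rw [h.2.resolve_left h1, hf]
  · congr 1
    ext p
    simp only [Finset.mem_filter, Finset.mem_univ, true_and, not_or]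

theorem chargedWeight_eq_mul_rest (i : Fin n) (x : Fin n → ℝ) :
    chargedWeight q x = Real.exp (-(q i * x i ^ 2 / 2)) *
      (∏ k ∈ Finset.univ.erase i, |x i - x k| ^ (q i * q k)) * chargedRest q i x := by
  rw [chargedWeight, prod_pairs_with (fun a b => |x a - x b| ^ (q a * q b))
    (fun a b => by rw [abs_sub_comm, mul_comm]) i,
    ← Finset.add_sum_erase _ _ (Finset.mem_univ i), neg_add, Real.exp_add, chargedRest]
  ring

theorem chargedRest_congr {q q' : Fin n → ℕ} {i : Fin n} {x x' : Fin n → ℝ}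
    (hq : ∀ k, k ≠ i → q k = q' k) (hx : ∀ k, k ≠ i → x k = x' k) :
    chargedRest q i x = chargedRest q' i x' := by
  unfold chargedRest
  congr 1
  · congr 2
    refine Finset.sum_congr rfl fun k hk => ?_
    rw [hq k (Finset.ne_of_mem_erase hk), hx k (Finset.ne_of_mem_erase hk)]
  · refine Finset.prod_congr rfl fun p hp => ?_
    simp only [Finset.mem_filter, Finset.mem_univ, true_and] at hp
    rw [hq _ hp.2.1, hq _ hp.2.2, hx _ hp.2.1, hx _ hp.2.2]

theorem chargedRest_update (i : Fin n) (x : Fin n → ℝ) (t : ℝ) :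
    chargedRest q i (Function.update x i t) = chargedRest q i x :=
  chargedRest_congr (fun _ _ => rfl) fun _ hk => Function.update_of_ne hk _ _

@[to_additive]
theorem prod_univ_erase_zero {M : Type*} [CommMonoid M] {n : ℕ} (f : Fin (n + 1) → M) :
    ∏ k ∈ Finset.univ.erase 0, f k = ∏ k : Fin n, f k.succ := by
  have h : (Finset.univ.erase (0 : Fin (n + 1))) = Finset.univ.map (Fin.succEmb n) := by
    ext k
    refine Fin.cases ?_ (fun k => ?_) k <;> simp
  rw [h, Finset.prod_map]
  rfl

theorem chargedRest_zero_cons (q : Fin (n + 1) → ℕ) (t : ℝ) (y : Fin n → ℝ) :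
    chargedRest q 0 (Fin.cons t y : Fin (n + 1) → ℝ) = chargedWeight (fun k => q k.succ) y := by
  unfold chargedRest chargedWeight
  congr 1
  · rw [sum_univ_erase_zero]
    simp
  · symm
    refine Finset.prod_nbij (fun p => (p.1.succ, p.2.succ)) ?_ ?_ ?_ ?_
    · intro p hp
      simpa using hp
    · rintro ⟨a, b⟩ - ⟨c, d⟩ - h
      simpa using h
    · rintro ⟨a, b⟩ h
      simp only [Finset.coe_filter, Finset.mem_univ, true_and, Set.mem_ofPred_eq] at h
      obtain ⟨c, rfl⟩ := Fin.exists_succ_eq.2 h.2.1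
      obtain ⟨d, rfl⟩ := Fin.exists_succ_eq.2 h.2.2
      exact ⟨(c, d), by simpa using h.1, rfl⟩
    · intro p _
      simp

/-- Dividing the weight by differences that appear in it, and multiplying by powers of a
coordinate, leaves an integrable function. -/
theorem integrable_chargedWeight_mul (hq : ∀ i, 1 ≤ q i) (i : Fin n) (d : Fin n → ℕ)
    (hd : ∀ k, d k ≤ q i * q k) (r : ℕ) :
    Integrable fun x => chargedWeight q x *
      ((∏ k ∈ Finset.univ.erase i, ((x i - x k)⁻¹) ^ d k) * x i ^ r) := by
  set Q : ℕ := ∑ a, ∑ b, q a * q b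
  -- every coordinate receives the same generous polynomial degree
  have hQ (a b : Fin n) : q a * q b ≤ Q :=
    (Finset.single_le_sum (f := fun b => q a * q b) (fun _ _ => Nat.zero_le _)
      (Finset.mem_univ b)).trans
      (Finset.single_le_sum (f := fun a => ∑ b, q a * q b) (fun _ _ => Nat.zero_le _)
      (Finset.mem_univ a))
  have h : Integrable fun x : Fin n → ℝ =>
      ∏ k, (Real.exp (-(x k ^ 2 / 2)) * (1 + |x k|) ^ (2 * n * Q + r)) :=
    Integrable.fintype_prod (f := fun (_ : Fin n) (t : ℝ) =>
      Real.exp (-(t ^ 2 / 2)) * (1 + |t|) ^ (2 * n * Q + r)) fun _ => integrable_factor _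
  refine h.mono' ?_ (Eventually.of_forall fun x => ?_)
  · refine ((continuous_chargedWeight q).measurable.mul ?_).aestronglyMeasurable
    fun_prop
  set B : Fin n → Fin n → ℝ := fun a b => (1 + |x a|) * (1 + |x b|)
  have hB (a b : Fin n) : 1 ≤ B a b := one_le_one_add_mul _ _
  have h1 (t : ℝ) : 1 ≤ 1 + |t| := by linarith [abs_nonneg t]
  have hprodB : ∏ p : Fin n × Fin n with p.1 < p.2, B p.1 p.2 ^ (q p.1 * q p.2) ≤
      ∏ k, (1 + |x k|) ^ (2 * n * Q) := by
    calc ∏ p : Fin n × Fin n with p.1 < p.2, B p.1 p.2 ^ (q p.1 * q p.2)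
        ≤ ∏ p : Fin n × Fin n with p.1 < p.2, B p.1 p.2 ^ Q :=
          Finset.prod_le_prod (fun p _ => by positivity) fun p _ =>
            pow_le_pow_right₀ (hB _ _) (hQ _ _)
      _ ≤ ∏ p : Fin n × Fin n, B p.1 p.2 ^ Q :=
          Finset.prod_le_prod_of_subset_of_one_le (Finset.filter_subset _ _)
            (fun p _ => by positivity) fun p _ _ => one_le_pow₀ (hB _ _)
      _ = ∏ k, (1 + |x k|) ^ (2 * n * Q) := by
          rw [Fintype.prod_prod_type]
          simp only [B, mul_pow, Finset.prod_mul_distrib, Finset.prod_const, Finset.card_univ,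
            Fintype.card_fin, Finset.prod_pow, ← pow_mul]
          rw [← pow_add]
          congr 1
          ring
  have hexp : Real.exp (-(∑ k, q k * x k ^ 2 / 2)) ≤ ∏ k, Real.exp (-(x k ^ 2 / 2)) := by
    rw [← Real.exp_sum, Finset.sum_neg_distrib]
    refine Real.exp_le_exp.2 (neg_le_neg (Finset.sum_le_sum fun k _ => ?_))
    have : (1 : ℝ) ≤ q k := by exact_mod_cast hq k
    nlinarith [sq_nonneg (x k)]
  have hx : |x i| ^ r ≤ ∏ k, (1 + |x k|) ^ r := by
    calc |x i| ^ r ≤ (1 + |x i|) ^ r := pow_le_pow_left₀ (abs_nonneg _) (by linarith) _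
      _ ≤ ∏ k, (1 + |x k|) ^ r := by
        rw [← Finset.mul_prod_erase _ _ (Finset.mem_univ i)]
        refine le_mul_of_one_le_right (by positivity) ?_
        exact Finset.one_le_prod fun k _ => one_le_pow₀ (h1 _)
  have hdiv : (∏ p : Fin n × Fin n with p.1 < p.2, |x p.1 - x p.2| ^ (q p.1 * q p.2)) *
      ∏ k ∈ Finset.univ.erase i, (|x i - x k|⁻¹) ^ d k ≤
      ∏ p : Fin n × Fin n with p.1 < p.2, B p.1 p.2 ^ (q p.1 * q p.2) := by
    rw [prod_pairs_with (fun a b => |x a - x b| ^ (q a * q b))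
      (fun a b => by rw [abs_sub_comm, mul_comm]) i,
      prod_pairs_with (fun a b => B a b ^ (q a * q b))
      (fun a b => by simp only [B]; rw [mul_comm (1 + |x a|), mul_comm (q a)]) i, mul_right_comm]
    refine mul_le_mul ?_ ?_ (Finset.prod_nonneg fun _ _ => by positivity)
      (Finset.prod_nonneg fun _ _ => by positivity)
    · exact prod_abs_pow_mul_inv_pow_le _ (fun k => x i - x k) (B i) (fun k => q i * q k) d
        (fun k _ => hB _ _) (fun k _ => abs_sub_le_one_add_mul _ _) fun k _ => hd k
    · exact Finset.prod_le_prod (fun p _ => by positivity) fun p _ =>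
        pow_le_pow_left₀ (abs_nonneg _) (abs_sub_le_one_add_mul _ _) _
  rw [norm_mul, Real.norm_of_nonneg (chargedWeight_nonneg q x), norm_mul, norm_pow,
    Real.norm_eq_abs, Finset.abs_prod, Real.norm_eq_abs]
  simp only [abs_pow, abs_inv]
  rw [chargedWeight]
  calc _ = Real.exp (-(∑ k, q k * x k ^ 2 / 2)) *
        ((∏ p : Fin n × Fin n with p.1 < p.2, |x p.1 - x p.2| ^ (q p.1 * q p.2)) *
          ∏ k ∈ Finset.univ.erase i, (|x i - x k|⁻¹) ^ d k) * |x i| ^ r := by ring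
    _ ≤ (∏ k, Real.exp (-(x k ^ 2 / 2))) * (∏ k, (1 + |x k|) ^ (2 * n * Q)) *
        ∏ k, (1 + |x k|) ^ r := by
      refine mul_le_mul (mul_le_mul hexp (hdiv.trans hprodB) ?_ ?_) hx (by positivity) ?_
      · exact mul_nonneg (Finset.prod_nonneg fun _ _ => by positivity)
          (Finset.prod_nonneg fun _ _ => by positivity)
      · exact Finset.prod_nonneg fun _ _ => by positivity
      · exact mul_nonneg (Finset.prod_nonneg fun _ _ => by positivity)
          (Finset.prod_nonneg fun _ _ => by positivity)
    _ = _ := by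
      simp only [← Finset.prod_mul_distrib, pow_add, mul_assoc]

theorem integrable_chargedWeight (hq : ∀ i, 1 ≤ q i) : Integrable (chargedWeight q) := by
  rcases isEmpty_or_nonempty (Fin n) with h | ⟨⟨i⟩⟩
  · exact (integrable_const (chargedWeight q isEmptyElim)).congr
      (Eventually.of_forall fun x => by simp only [Subsingleton.elim x isEmptyElim])
  · simpa using integrable_chargedWeight_mul q hq i 0 (fun _ => Nat.zero_le _) 0

theorem integrable_chargedWeight_mul_inv_mul_self (hq : ∀ i, 1 ≤ q i) {i j : Fin n} (hij : i ≠ j) :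
    Integrable fun x => chargedWeight q x * ((x i - x j)⁻¹ * x i) := by
  have h := integrable_chargedWeight_mul q hq i (fun l => if l = j then 1 else 0)
    (fun k => by have := hq i; have := hq k; split_ifs <;> nlinarith) 1
  simpa only [pow_ite, pow_one, pow_zero, Finset.prod_ite_eq',
    if_pos (Finset.mem_erase.2 ⟨hij.symm, Finset.mem_univ j⟩)] using h

theorem integrable_chargedWeight_mul_inv_mul_inv (hq : ∀ i, 1 ≤ q i) {i j k : Fin n} (hij : i ≠ j)
    (hik : i ≠ k) (hjk : j = k → 2 ≤ q i * q j) :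
    Integrable fun x => chargedWeight q x * ((x i - x j)⁻¹ * (x i - x k)⁻¹) := by
  have h := integrable_chargedWeight_mul q hq i
    (fun l => (if l = j then 1 else 0) + if l = k then 1 else 0)
    (fun l => by
      have := Nat.mul_le_mul (hq i) (hq l)
      split_ifs with h1 h2 <;> grind) 0
  simpa only [pow_add, pow_ite, pow_one, pow_zero, mul_one, Finset.prod_mul_distrib,
    Finset.prod_ite_eq', if_pos (Finset.mem_erase.2 ⟨hij.symm, Finset.mem_univ j⟩),
    if_pos (Finset.mem_erase.2 ⟨hik.symm, Finset.mem_univ k⟩)] using h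

end Charged

/-! ### The divergence identities -/

theorem integral_eq_integral_insertNth {n : ℕ} (i : Fin (n + 1)) {H : (Fin (n + 1) → ℝ) → ℝ}
    (hH : Integrable H) :
    ∫ x, H x = ∫ y : Fin n → ℝ, ∫ t : ℝ, H (i.insertNth (α := fun _ => ℝ) t y) := by
  have hm := (volume_preserving_piFinSuccAbove (fun _ : Fin (n + 1) => ℝ) i).symm
  have hi := (hm.integrable_comp_emb (MeasurableEquiv.measurableEmbedding _)).2 hH
  rw [← hm.integral_comp' H]
  exact integral_prod_symm _ hi

theorem integral_eq_zero_of_integral_update_eq_zero {n : ℕ} (i : Fin n) {H : (Fin n → ℝ) → ℝ}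
    (h : ∀ x, ∫ t, H (Function.update x i t) = 0) : ∫ x, H x = 0 := by
  by_cases hH : Integrable H
  · obtain ⟨m, rfl⟩ := Nat.exists_eq_succ_of_ne_zero (Fin.pos i).ne'
    rw [integral_eq_integral_insertNth i hH]
    refine integral_eq_zero_of_ae (Eventually.of_forall fun y => ?_)
    have := h (i.insertNth (α := fun _ => ℝ) 0 y)
    simpa only [Fin.update_insertNth, Pi.zero_apply] using this
  · exact integral_undef hH

/-- The exponents of the particles seen by particle `i`, once the weight is divided by the
difference of the positions of `i` and `j`. -/
def reducedExponent {n : ℕ} (q : Fin n → ℕ) (i j k : Fin n) : ℕ :=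
  q i * q k - if k = j then 1 else 0

/-- The derivative in the `i`-th coordinate of `chargedWeight q x / (x i - x j)`, away from
coinciding positions. -/
noncomputable def pairDerivative {n : ℕ} (q : Fin n → ℕ) (i j : Fin n) (x : Fin n → ℝ) : ℝ :=
  chargedWeight q x * ((x i - x j)⁻¹ *
    (∑ k ∈ Finset.univ.erase i, (reducedExponent q i j k : ℝ) * (x i - x k)⁻¹ - q i * x i))

section Charged

variable {n : ℕ} (q : Fin n → ℕ)

theorem integrable_pairDerivative (hq : ∀ i, 1 ≤ q i) {i j : Fin n} (hij : i ≠ j) :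
    Integrable (pairDerivative q i j) := by
  have h : pairDerivative q i j = fun x =>
      ∑ k ∈ Finset.univ.erase i, (reducedExponent q i j k : ℝ) *
        (chargedWeight q x * ((x i - x j)⁻¹ * (x i - x k)⁻¹)) -
      q i * (chargedWeight q x * ((x i - x j)⁻¹ * x i)) := by
    funext x
    rw [pairDerivative, mul_sub, mul_sub, Finset.mul_sum, Finset.mul_sum]
    congr 1
    · exact Finset.sum_congr rfl fun k _ => by ring
    · ring
  rw [h]
  refine (integrable_finsetSum _ fun k hk => ?_).sub
    ((integrable_chargedWeight_mul_inv_mul_self q hq hij).const_mul _)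
  by_cases h0 : reducedExponent q i j k = 0
  · simp [h0]
  · refine (integrable_chargedWeight_mul_inv_mul_inv q hq hij
      (Finset.ne_of_mem_erase hk).symm fun hjk => ?_).const_mul _
    subst hjk
    simp only [reducedExponent, if_true] at h0
    omega

/-- Along the `i`-th coordinate, `chargedWeight q x / (x i - x j)` changes sign at `x j`; if it
does so by a jump, the integral of its derivative is minus the height of the jump. -/
theorem integral_pairDerivative_update (hq : ∀ i, 1 ≤ q i) {i j : Fin n} (hij : i ≠ j)
    (x : Fin n → ℝ) :
    ∫ t, pairDerivative q i j (Function.update x i t) =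
      -2 * (profile (Finset.univ.erase i) x (reducedExponent q i j) (q i) (x j) *
        chargedRest q i x) := by
  have hβ : (1 : ℝ) ≤ q i := by exact_mod_cast hq i
  have hj : j ∈ Finset.univ.erase i := Finset.mem_erase.2 ⟨hij.symm, Finset.mem_univ j⟩
  rw [← mul_assoc, ← integral_sign_mul_profile_mul_force _ _ _ _ hβ, ← integral_mul_const]
  congr 1
  funext t
  have hsum : ∑ k ∈ Finset.univ.erase i, (reducedExponent q i j k : ℝ) *
      (t - Function.update x i t k)⁻¹ =
      ∑ k ∈ Finset.univ.erase i, (reducedExponent q i j k : ℝ) * (t - x k)⁻¹ :=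
    Finset.sum_congr rfl fun k hk => by
      rw [Function.update_of_ne (Finset.ne_of_mem_erase hk)]
  have hprod : ∏ k ∈ Finset.univ.erase i, |t - Function.update x i t k| ^ (q i * q k) =
      |t - x j| * ∏ k ∈ Finset.univ.erase i, |t - x k| ^ reducedExponent q i j k := by
    rw [← Finset.mul_prod_erase _ _ hj, ← Finset.mul_prod_erase _
      (fun k => |t - x k| ^ reducedExponent q i j k) hj, Function.update_of_ne hij.symm,
      ← mul_assoc]
    congr 1
    · rw [reducedExponent, if_pos rfl, ← pow_succ', Nat.sub_add_cancel]
      exact Nat.mul_le_mul (hq i) (hq j)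
    · refine Finset.prod_congr rfl fun k hk => ?_
      rw [Finset.mem_erase, Finset.mem_erase] at hk
      rw [reducedExponent, if_neg hk.1, Function.update_of_ne hk.2.1, Nat.sub_zero]
  rw [pairDerivative, chargedWeight_eq_mul_rest q i, chargedRest_update,
    Function.update_self, Function.update_of_ne hij.symm, hsum, hprod, profile, profileForce]
  have hs : |t - x j| * (t - x j)⁻¹ = (SignType.sign (t - x j) : ℝ) := by
    rcases eq_or_ne (t - x j) 0 with h | h
    · simp [h]
    · rw [mul_inv_eq_iff_eq_mul₀ h, sign_mul_self]
  rw [← hs]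
  ring

theorem integral_pairDerivative_eq_zero (hq : ∀ i, 1 ≤ q i) {i j : Fin n} (hij : i ≠ j)
    (h2 : 2 ≤ q i * q j) : ∫ x, pairDerivative q i j x = 0 := by
  refine integral_eq_zero_of_integral_update_eq_zero i fun x => ?_
  rw [integral_pairDerivative_update q hq hij, profile,
    Finset.prod_eq_zero (Finset.mem_erase.2 ⟨hij.symm, Finset.mem_univ j⟩)]
  · ring
  · rw [sub_self, abs_zero, zero_pow]
    rw [reducedExponent, if_pos rfl]
    omega

end Charged

/-! ### Merging two particles -/

/-- The charges after two unit particles have merged into one particle, of index `0`. -/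
def mergedCharge (m : ℕ) : Fin (m + 1) → ℕ := Function.update 1 0 2

@[simp] theorem mergedCharge_zero (m : ℕ) : mergedCharge m 0 = 2 := by simp [mergedCharge]

theorem mergedCharge_of_ne {m : ℕ} {k : Fin (m + 1)} (hk : k ≠ 0) : mergedCharge m k = 1 := by
  simp [mergedCharge, hk]

theorem one_le_mergedCharge (m : ℕ) (k : Fin (m + 1)) : 1 ≤ mergedCharge m k := by
  rcases eq_or_ne k 0 with rfl | h
  · simp
  · rw [mergedCharge_of_ne h]

theorem weight_cons {n : ℕ} (t : ℝ) (y : Fin n → ℝ) :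
    weight (n + 1) (Fin.cons t y : Fin (n + 1) → ℝ) =
      Real.exp (-(t ^ 2 / 2)) * (∏ k, |t - y k|) * weight n y := by
  rw [weight_eq_chargedWeight, weight_eq_chargedWeight, chargedWeight_eq_mul_rest _ 0,
    chargedRest_zero_cons, prod_univ_erase_zero]
  simp only [Pi.one_apply, Nat.cast_one, one_mul, Fin.cons_zero, Fin.cons_succ, mul_one, pow_one]
  rfl

theorem weight_eq_mul_rest {m : ℕ} (y : Fin (m + 1) → ℝ) :
    weight (m + 1) y = Real.exp (-(y 0 ^ 2 / 2)) *
      (∏ k ∈ Finset.univ.erase 0, |y 0 - y k|) * chargedRest (mergedCharge m) 0 y := by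
  rw [weight_eq_chargedWeight, chargedWeight_eq_mul_rest _ 0,
    chargedRest_congr (q := 1) (q' := mergedCharge m) (x' := y)
      (fun k hk => (mergedCharge_of_ne hk).symm) fun _ _ => rfl]
  simp

theorem mergedWeight_eq_mul_rest {m : ℕ} (y : Fin (m + 1) → ℝ) :
    chargedWeight (mergedCharge m) y = Real.exp (-(y 0 ^ 2)) *
      (∏ k ∈ Finset.univ.erase 0, |y 0 - y k| ^ 2) * chargedRest (mergedCharge m) 0 y := by
  rw [chargedWeight_eq_mul_rest _ 0]
  congr 2
  · simp
  · refine Finset.prod_congr rfl fun k hk => ?_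
    rw [mergedCharge_of_ne (Finset.ne_of_mem_erase hk), mergedCharge_zero]

theorem integral_pairDerivative_one (m : ℕ) :
    ∫ x, pairDerivative (1 : Fin (m + 2) → ℕ) 0 1 x =
      -2 * ∫ y, chargedWeight (mergedCharge m) y := by
  have h01 : (0 : Fin (m + 2)) ≠ 1 := by simp
  rw [integral_eq_integral_insertNth 0 (integrable_pairDerivative 1 (fun _ => le_rfl) h01),
    ← integral_const_mul]
  congr 1
  funext y
  have h := integral_pairDerivative_update (1 : Fin (m + 2) → ℕ) (fun _ => le_rfl) h01
    ((0 : Fin (m + 2)).insertNth (α := fun _ => ℝ) 0 y)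
  simp only [Fin.update_insertNth] at h
  rw [h]
  congr 1
  rw [Fin.insertNth_zero', chargedRest_zero_cons, profile, prod_univ_erase_zero,
    ← Finset.mul_prod_erase _ _ (Finset.mem_univ (0 : Fin (m + 1)))]
  have hprod : ∏ k ∈ Finset.univ.erase (0 : Fin (m + 1)),
      |(Fin.cons 0 y : Fin (m + 2) → ℝ) 1 - (Fin.cons 0 y : Fin (m + 2) → ℝ) k.succ| ^
        reducedExponent (1 : Fin (m + 2) → ℕ) 0 1 k.succ =
      ∏ k ∈ Finset.univ.erase (0 : Fin (m + 1)), |y 0 - y k| := by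
    refine Finset.prod_congr rfl fun k hk => ?_
    have : k.succ ≠ (1 : Fin (m + 2)) := fun h' =>
      Finset.ne_of_mem_erase hk (Fin.succ_injective _ (by simpa using h'))
    rw [reducedExponent, if_neg this, Fin.cons_succ]
    simp only [Pi.one_apply, mul_one, Nat.sub_zero, pow_one]
    rfl
  have hw : chargedWeight (fun k : Fin (m + 1) => (1 : Fin (m + 2) → ℕ) k.succ) y =
      weight (m + 1) y := (weight_eq_chargedWeight y).symm
  rw [hprod, hw, weight_eq_mul_rest, mergedWeight_eq_mul_rest]
  have h1 : (Fin.cons 0 y : Fin (m + 2) → ℝ) 1 = y 0 := rfl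
  rw [Finset.prod_pow, h1]
  have he : Real.exp (-(y 0 ^ 2)) = Real.exp (-(y 0 ^ 2 / 2)) * Real.exp (-(y 0 ^ 2 / 2)) := by
    rw [← Real.exp_add]; ring_nf
  rw [he]
  simp [reducedExponent]
  ring

/-! ### Permutation invariance -/

@[to_additive]
theorem prod_pairs_comp_perm {M : Type*} [CommMonoid M] {n : ℕ} (f : Fin n → Fin n → M)
    (hf : ∀ a b, f a b = f b a) (σ : Equiv.Perm (Fin n)) :
    ∏ p : Fin n × Fin n with p.1 < p.2, f (σ p.1) (σ p.2) =
      ∏ p : Fin n × Fin n with p.1 < p.2, f p.1 p.2 := by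
  refine Finset.prod_nbij'
    (fun p => if σ p.1 < σ p.2 then (σ p.1, σ p.2) else (σ p.2, σ p.1))
    (fun p => if σ.symm p.1 < σ.symm p.2 then (σ.symm p.1, σ.symm p.2)
      else (σ.symm p.2, σ.symm p.1)) ?_ ?_ ?_ ?_ ?_
  · rintro ⟨a, b⟩ h
    simp only [Finset.mem_filter, Finset.mem_univ, true_and] at h ⊢
    have := σ.injective.ne h.ne
    split_ifs <;> grind
  · rintro ⟨a, b⟩ h
    simp only [Finset.mem_filter, Finset.mem_univ, true_and] at h ⊢
    have := σ.symm.injective.ne h.ne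
    split_ifs <;> grind
  · rintro ⟨a, b⟩ h
    simp only [Finset.mem_filter, Finset.mem_univ, true_and] at h ⊢
    split_ifs <;> grind
  · rintro ⟨a, b⟩ h
    simp only [Finset.mem_filter, Finset.mem_univ, true_and] at h ⊢
    split_ifs <;> grind
  · rintro ⟨a, b⟩ h
    dsimp only
    split_ifs with h1
    · rfl
    · exact hf _ _

theorem weight_comp_perm {n : ℕ} (σ : Equiv.Perm (Fin n)) (x : Fin n → ℝ) :
    weight n (x ∘ σ) = weight n x := by
  unfold weight
  congr 1
  · rw [← Equiv.sum_comp σ (fun i => x i ^ 2 / 2)]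
    rfl
  · exact prod_pairs_comp_perm (fun a b => |x a - x b|) (fun a b => abs_sub_comm _ _) σ

theorem comp_perm_eq_piCongrLeft {n : ℕ} (σ : Equiv.Perm (Fin n)) :
    (fun x : Fin n → ℝ => x ∘ σ) =
      MeasurableEquiv.piCongrLeft (fun _ : Fin n => ℝ) σ.symm := by
  funext x i
  obtain ⟨j, rfl⟩ := σ.symm.surjective i
  simp [MeasurableEquiv.coe_piCongrLeft]

theorem measurePreserving_comp_perm {n : ℕ} (σ : Equiv.Perm (Fin n)) :
    MeasurePreserving (fun x : Fin n → ℝ => x ∘ σ) := by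
  rw [comp_perm_eq_piCongrLeft]
  exact volume_measurePreserving_piCongrLeft (fun _ : Fin n => ℝ) σ.symm

theorem measurableEmbedding_comp_perm {n : ℕ} (σ : Equiv.Perm (Fin n)) :
    MeasurableEmbedding (fun x : Fin n → ℝ => x ∘ σ) := by
  rw [comp_perm_eq_piCongrLeft]
  exact MeasurableEquiv.measurableEmbedding _

theorem integral_weight_mul_comp_perm {n : ℕ} (σ : Equiv.Perm (Fin n)) (g : (Fin n → ℝ) → ℝ) :
    ∫ x, weight n x * g (x ∘ σ) = ∫ x, weight n x * g x := by
  rw [← (measurePreserving_comp_perm σ).integral_comp (measurableEmbedding_comp_perm σ)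
    fun x => weight n x * g x]
  simp only [weight_comp_perm]

theorem weight_eq_zero_of_eq {n : ℕ} {x : Fin n → ℝ} {i j : Fin n} (hij : i ≠ j)
    (h : x i = x j) : weight n x = 0 := by
  rw [weight_eq_chargedWeight]
  exact chargedWeight_eq_zero_of_eq 1 (fun _ => le_rfl) hij h

/-! ### The merged gas -/

theorem integrable_weight_mul_inv_mul_inv {n : ℕ} {i j k : Fin n} (hij : i ≠ j) (hik : i ≠ k)
    (hjk : j ≠ k) : Integrable fun x => weight n x * ((x i - x j)⁻¹ * (x i - x k)⁻¹) := by
  simpa only [weight_eq_chargedWeight] using integrable_chargedWeight_mul_inv_mul_inv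
    1 (fun _ => le_rfl) hij hik fun h => absurd h hjk

/-- Summing over the three choices of the distinguished particle gives zero pointwise. -/
theorem integral_weight_mul_inv_mul_inv {n : ℕ} {i j k : Fin n} (hij : i ≠ j) (hik : i ≠ k)
    (hjk : j ≠ k) : ∫ x, weight n x * ((x i - x j)⁻¹ * (x i - x k)⁻¹) = 0 := by
  set g : (Fin n → ℝ) → ℝ := fun x => (x i - x j)⁻¹ * (x i - x k)⁻¹
  have h1 : ∫ x, weight n x * ((x j - x i)⁻¹ * (x j - x k)⁻¹) = ∫ x, weight n x * g x := by
    rw [← integral_weight_mul_comp_perm (Equiv.swap i j) g]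
    simp only [g, Function.comp_apply, Equiv.swap_apply_left, Equiv.swap_apply_right,
      Equiv.swap_apply_of_ne_of_ne hik.symm hjk.symm]
  have h2 : ∫ x, weight n x * ((x k - x j)⁻¹ * (x k - x i)⁻¹) = ∫ x, weight n x * g x := by
    rw [← integral_weight_mul_comp_perm (Equiv.swap i k) g]
    simp only [g, Function.comp_apply, Equiv.swap_apply_left, Equiv.swap_apply_right,
      Equiv.swap_apply_of_ne_of_ne hij.symm hjk]
  have h3 : ∫ x, weight n x * g x + weight n x * ((x j - x i)⁻¹ * (x j - x k)⁻¹) +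
      weight n x * ((x k - x j)⁻¹ * (x k - x i)⁻¹) = 0 := by
    refine integral_eq_zero_of_ae (Eventually.of_forall fun x => ?_)
    simp only [g, Pi.zero_apply]
    by_cases a : x i = x j
    · simp [weight_eq_zero_of_eq hij a]
    by_cases b : x i = x k
    · simp [weight_eq_zero_of_eq hik b]
    by_cases c : x j = x k
    · simp [weight_eq_zero_of_eq hjk c]
    have a1 := sub_ne_zero.2 a
    have b1 := sub_ne_zero.2 b
    have c1 := sub_ne_zero.2 c
    rw [← neg_sub (x i) (x j), ← neg_sub (x i) (x k), ← neg_sub (x j) (x k)]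
    field_simp
    ring
  have i1 := integrable_weight_mul_inv_mul_inv hij hik hjk
  have i2 := integrable_weight_mul_inv_mul_inv hij.symm hjk hik
  have i3 := integrable_weight_mul_inv_mul_inv hjk.symm hik.symm hij.symm
  have i12 : Integrable fun x => weight n x * g x +
      weight n x * ((x j - x i)⁻¹ * (x j - x k)⁻¹) := i1.add i2
  rw [integral_add i12 i3, integral_add i1 i2, h1, h2] at h3
  linarith

theorem integral_weight_mul_inv_mul_self {n : ℕ} {i j : Fin n} (hij : i ≠ j) :
    ∫ x, weight n x * ((x i - x j)⁻¹ * x i) = partitionFunction n / 2 := by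
  set g : (Fin n → ℝ) → ℝ := fun x => (x i - x j)⁻¹ * x i
  have h1 : ∫ x, weight n x * ((x j - x i)⁻¹ * x j) = ∫ x, weight n x * g x := by
    rw [← integral_weight_mul_comp_perm (Equiv.swap i j) g]
    simp only [g, Function.comp_apply, Equiv.swap_apply_left, Equiv.swap_apply_right]
  have h2 : ∫ x, weight n x * g x + weight n x * ((x j - x i)⁻¹ * x j) = partitionFunction n := by
    rw [partitionFunction]
    congr 1
    funext x
    by_cases a : x i = x j
    · simp [weight_eq_zero_of_eq hij a]
    have a1 := sub_ne_zero.2 a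
    simp only [g]
    rw [← neg_sub (x i) (x j)]
    field_simp
    ring
  have hi {i j : Fin n} (hij : i ≠ j) :
      Integrable fun x => weight n x * ((x i - x j)⁻¹ * x i) := by
    simpa only [weight_eq_chargedWeight] using
      integrable_chargedWeight_mul_inv_mul_self 1 (fun _ => le_rfl) hij
  rw [integral_add (hi hij) (hi hij.symm), h1] at h2
  linarith

/-- Merging two of the particles divides the partition function by `4`, whatever their number. -/
theorem integral_mergedWeight (m : ℕ) :
    ∫ y, chargedWeight (mergedCharge m) y = partitionFunction (m + 2) / 4 := by
  have h01 : (0 : Fin (m + 2)) ≠ 1 := by simp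
  have h := integral_pairDerivative_one m
  have e : pairDerivative (1 : Fin (m + 2) → ℕ) 0 1 = fun x =>
      ∑ k ∈ (Finset.univ.erase 0).erase 1,
        weight (m + 2) x * ((x 0 - x 1)⁻¹ * (x 0 - x k)⁻¹) -
      weight (m + 2) x * ((x 0 - x 1)⁻¹ * x 0) := by
    funext x
    rw [pairDerivative, ← weight_eq_chargedWeight, ← Finset.add_sum_erase _ _
      (Finset.mem_erase.2 ⟨h01.symm, Finset.mem_univ _⟩), ← Finset.mul_sum, ← Finset.mul_sum]
    have hs : ∑ k ∈ (Finset.univ.erase 0).erase 1,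
        (reducedExponent (1 : Fin (m + 2) → ℕ) 0 1 k : ℝ) * (x 0 - x k)⁻¹ =
        ∑ k ∈ (Finset.univ.erase 0).erase 1, (x 0 - x k)⁻¹ :=
      Finset.sum_congr rfl fun k hk => by
        simp [reducedExponent, Finset.ne_of_mem_erase hk]
    rw [hs]
    simp only [reducedExponent, if_true, Pi.one_apply, mul_one, Nat.sub_self, Nat.cast_zero,
      zero_mul, zero_add, Nat.cast_one, one_mul]
    ring
  have hk {k : Fin (m + 2)} (hk : k ∈ (Finset.univ.erase 0).erase 1) : 0 ≠ k ∧ 1 ≠ k := by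
    simp only [Finset.mem_erase, Finset.mem_univ, and_true] at hk
    exact ⟨hk.2.symm, hk.1.symm⟩
  have hi : Integrable fun x => weight (m + 2) x * ((x 0 - x 1)⁻¹ * x 0) := by
    simpa only [weight_eq_chargedWeight] using
      integrable_chargedWeight_mul_inv_mul_self (1 : Fin (m + 2) → ℕ) (fun _ => le_rfl) h01
  rw [e, integral_sub (integrable_finsetSum _ fun k h' =>
      integrable_weight_mul_inv_mul_inv h01 (hk h').1 (hk h').2) hi,
    integral_finsetSum _ fun k h' =>
      integrable_weight_mul_inv_mul_inv h01 (hk h').1 (hk h').2,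
    Finset.sum_eq_zero fun k h' => integral_weight_mul_inv_mul_inv h01 (hk h').1 (hk h').2,
    integral_weight_mul_inv_mul_self h01] at h
  linarith

/-- The junk value `0⁻¹ = 0` removes the diagonal terms of the double sum. -/
theorem sum_sum_inv_mul_inv_sub {ι : Type*} [DecidableEq ι] (T : Finset ι) (z : ι → ℝ)
    (hz : ∀ i ∈ T, ∀ k ∈ T, i ≠ k → z i ≠ z k) (h0 : ∀ i ∈ T, z i ≠ 0) :
    ∑ i ∈ T, ∑ k ∈ T, (z i)⁻¹ * (z i - z k)⁻¹ =
      (∑ i ∈ T, (z i)⁻¹ ^ 2 - (∑ i ∈ T, (z i)⁻¹) ^ 2) / 2 := by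
  have h1 : ∑ i ∈ T, ∑ k ∈ T, (z i)⁻¹ * (z i - z k)⁻¹ +
      ∑ i ∈ T, ∑ k ∈ T, (z k)⁻¹ * (z k - z i)⁻¹ =
      ∑ i ∈ T, (z i)⁻¹ ^ 2 - (∑ i ∈ T, (z i)⁻¹) ^ 2 := by
    rw [sq (∑ i ∈ T, (z i)⁻¹), Finset.sum_mul_sum, ← Finset.sum_add_distrib,
      ← Finset.sum_sub_distrib]
    refine Finset.sum_congr rfl fun i hi => ?_
    rw [← Finset.sum_add_distrib, ← Finset.add_sum_erase _ _ hi,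
      ← Finset.add_sum_erase _ (fun k => (z i)⁻¹ * (z k)⁻¹) hi]
    have : ∑ k ∈ T.erase i, ((z i)⁻¹ * (z i - z k)⁻¹ + (z k)⁻¹ * (z k - z i)⁻¹) =
        -∑ k ∈ T.erase i, (z i)⁻¹ * (z k)⁻¹ := by
      rw [← Finset.sum_neg_distrib]
      refine Finset.sum_congr rfl fun k hk => ?_
      have hkT := Finset.mem_of_mem_erase hk
      have a := sub_ne_zero.2 (hz i hi k hkT (Finset.ne_of_mem_erase hk).symm)
      have b := h0 i hi
      have c := h0 k hkT
      rw [← neg_sub (z i) (z k)]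
      field_simp
      ring
    rw [this]
    simp
    ring
  have h2 : ∑ i ∈ T, ∑ k ∈ T, (z k)⁻¹ * (z k - z i)⁻¹ =
      ∑ i ∈ T, ∑ k ∈ T, (z i)⁻¹ * (z i - z k)⁻¹ := Finset.sum_comm
  linarith

/-- The vector field with components `1 / (x i - x 0)` on the unit particles and
`-1/2 ∑ 1 / (x i - x 0)` on the merged one is chosen so that the mixed terms of its divergence
combine to a square and the confinement contributes only a constant. -/
theorem sum_pairDerivative_mergedCharge {m : ℕ} (x : Fin (m + 1) → ℝ) :
    ∑ i ∈ Finset.univ.erase 0, (pairDerivative (mergedCharge m) i 0 x +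
        pairDerivative (mergedCharge m) 0 i x / 2) =
      chargedWeight (mergedCharge m) x * (∑ i ∈ Finset.univ.erase 0, (x i - x 0)⁻¹ ^ 2 +
        (∑ i ∈ Finset.univ.erase 0, (x i - x 0)⁻¹) ^ 2 / 2 - m) := by
  simp only [pairDerivative]
  by_cases hinj : Function.Injective x
  swap
  · simp only [Function.Injective, not_forall] at hinj
    obtain ⟨a, b, h, hab⟩ := hinj
    simp [chargedWeight_eq_zero_of_eq _ (one_le_mergedCharge m) hab h]
  set T : Finset (Fin (m + 1)) := Finset.univ.erase 0
  set W := chargedWeight (mergedCharge m) x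
  have hT {i : Fin (m + 1)} (hi : i ∈ T) : i ≠ 0 := Finset.ne_of_mem_erase hi
  set z : Fin (m + 1) → ℝ := fun i => x i - x 0
  have hz0 {i : Fin (m + 1)} (hi : i ∈ T) : z i ≠ 0 := sub_ne_zero.2 (hinj.ne (hT hi))
  set S : ℝ := ∑ i ∈ T, (z i)⁻¹
  have h1 {i : Fin (m + 1)} (hi : i ∈ T) :
      ∑ k ∈ Finset.univ.erase i, (reducedExponent (mergedCharge m) i 0 k : ℝ) * (x i - x k)⁻¹ =
        (z i)⁻¹ + ∑ k ∈ T, (z i - z k)⁻¹ := by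
    have hb : ∑ k ∈ Finset.univ.erase i,
        (reducedExponent (mergedCharge m) i 0 k : ℝ) * (x i - x k)⁻¹ =
        ∑ k, (x i - x k)⁻¹ := by
      rw [← Finset.add_sum_erase _ _ (Finset.mem_univ i), sub_self, inv_zero, zero_add]
      refine Finset.sum_congr rfl fun k _ => ?_
      rw [reducedExponent, mergedCharge_of_ne (hT hi)]
      split_ifs with hk
      · simp [hk]
      · simp [mergedCharge_of_ne hk]
    rw [hb, ← Finset.add_sum_erase _ _ (Finset.mem_univ 0)]
    congr 1
    exact Finset.sum_congr rfl fun k _ => by simp only [z, sub_sub_sub_cancel_right]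
  have h2 {i : Fin (m + 1)} (hi : i ∈ T) :
      ∑ k ∈ T, (reducedExponent (mergedCharge m) 0 i k : ℝ) * (x 0 - x k)⁻¹ =
        (z i)⁻¹ - 2 * S := by
    have hk {k : Fin (m + 1)} (hk : k ∈ T) :
        (reducedExponent (mergedCharge m) 0 i k : ℝ) * (x 0 - x k)⁻¹ =
          (if k = i then (z k)⁻¹ else 0) - 2 * (z k)⁻¹ := by
      rw [reducedExponent, mergedCharge_of_ne (hT hk), ← neg_sub (x k) (x 0), inv_neg]
      split_ifs with h
      · simp [z]; ring
      · simp [z]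
    rw [Finset.sum_congr rfl fun k h => hk h, Finset.sum_sub_distrib, ← Finset.mul_sum,
      Finset.sum_ite_eq' T i, if_pos hi]
  have hterm {i : Fin (m + 1)} (hi : i ∈ T) :
      W * ((x i - x 0)⁻¹ * (∑ k ∈ Finset.univ.erase i,
        (reducedExponent (mergedCharge m) i 0 k : ℝ) * (x i - x k)⁻¹ -
          (mergedCharge m i : ℝ) * x i)) +
      W * ((x 0 - x i)⁻¹ * (∑ k ∈ T,
        (reducedExponent (mergedCharge m) 0 i k : ℝ) * (x 0 - x k)⁻¹ -
          (mergedCharge m 0 : ℝ) * x 0)) / 2 =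
      W * ((z i)⁻¹ ^ 2 / 2 + ∑ k ∈ T, (z i)⁻¹ * (z i - z k)⁻¹ + S * (z i)⁻¹ - 1) := by
    rw [h1 hi, h2 hi, mergedCharge_of_ne (hT hi), mergedCharge_zero,
      ← Finset.mul_sum, ← neg_sub (x i) (x 0), inv_neg]
    have e : x i = z i + x 0 := by simp [z]
    have e' : (z i)⁻¹ * z i = 1 := inv_mul_cancel₀ (hz0 hi)
    change W * ((z i)⁻¹ * _) + W * (-(z i)⁻¹ * _) / 2 = _
    rw [e]
    push_cast
    linear_combination (-W) * e'
  rw [Finset.sum_congr rfl fun i hi => hterm hi, ← Finset.mul_sum, Finset.sum_sub_distrib,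
    Finset.sum_add_distrib, Finset.sum_add_distrib, ← Finset.mul_sum, ← Finset.sum_div,
    sum_sum_inv_mul_inv_sub T z
      (fun i _ k _ hik h => hinj.ne hik (by simpa [z] using h)) fun i hi => hz0 hi]
  have hc : ∑ i ∈ T, (1 : ℝ) = m := by simp [T]
  rw [hc]
  change W * (_ + S * S - _) = _
  ring

/-- The merged weight times the sum of the inverse squared distances from the merged particle to
the others, a large quantity when one of them is close to it. -/
noncomputable def mergedDensity (m : ℕ) (y : Fin (m + 1) → ℝ) : ℝ :=
  chargedWeight (mergedCharge m) y * ∑ i ∈ Finset.univ.erase 0, (y i - y 0)⁻¹ ^ 2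

theorem mergedDensity_nonneg (m : ℕ) (y : Fin (m + 1) → ℝ) : 0 ≤ mergedDensity m y :=
  mul_nonneg (chargedWeight_nonneg _ _) (Finset.sum_nonneg fun _ _ => sq_nonneg _)

theorem measurable_mergedDensity (m : ℕ) : Measurable (mergedDensity m) := by
  refine (continuous_chargedWeight _).measurable.mul ?_
  fun_prop

theorem integrable_mergedDensity (m : ℕ) : Integrable (mergedDensity m) := by
  unfold mergedDensity
  simp only [Finset.mul_sum, sq]
  refine integrable_finsetSum _ fun i hi => ?_
  have hi' := Finset.ne_of_mem_erase hi
  exact integrable_chargedWeight_mul_inv_mul_inv _ (one_le_mergedCharge m) hi' hi' fun _ => by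
    rw [mergedCharge_zero, mergedCharge_of_ne hi']

theorem integral_mergedDensity_le (m : ℕ) :
    ∫ x, mergedDensity m x ≤ m * (partitionFunction (m + 2) / 4) := by
  have hq := one_le_mergedCharge m
  set T : Finset (Fin (m + 1)) := Finset.univ.erase 0
  have hT {i : Fin (m + 1)} (hi : i ∈ T) : i ≠ 0 := Finset.ne_of_mem_erase hi
  have hi1 {i : Fin (m + 1)} (hi : i ∈ T) := integrable_pairDerivative _ hq (hT hi)
  have hi2 {i : Fin (m + 1)} (hi : i ∈ T) :=
    (integrable_pairDerivative _ hq (hT hi).symm).div_const 2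
  have hi12 {i : Fin (m + 1)} (hi : i ∈ T) : Integrable fun x =>
      pairDerivative (mergedCharge m) i 0 x + pairDerivative (mergedCharge m) 0 i x / 2 :=
    (hi1 hi).add (hi2 hi)
  have hsum : ∫ x, ∑ i ∈ T, (pairDerivative (mergedCharge m) i 0 x +
      pairDerivative (mergedCharge m) 0 i x / 2) = 0 := by
    rw [integral_finsetSum _ fun i hi => hi12 hi]
    refine Finset.sum_eq_zero fun i hi => ?_
    rw [integral_add (hi1 hi) (hi2 hi), integral_div,
      integral_pairDerivative_eq_zero _ hq (hT hi), integral_pairDerivative_eq_zero _ hq (hT hi).symm]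
    · simp
    · rw [mergedCharge_zero, mergedCharge_of_ne (hT hi)]
    · rw [mergedCharge_zero, mergedCharge_of_ne (hT hi)]
  have hint : Integrable fun x => ∑ i ∈ T, (pairDerivative (mergedCharge m) i 0 x +
      pairDerivative (mergedCharge m) 0 i x / 2) :=
    integrable_finsetSum _ fun i hi => hi12 hi
  have hW := (integrable_chargedWeight _ hq).const_mul (m : ℝ)
  calc _ ≤ ∫ x, (∑ i ∈ T, (pairDerivative (mergedCharge m) i 0 x +
        pairDerivative (mergedCharge m) 0 i x / 2) + m * chargedWeight (mergedCharge m) x) := by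
        refine integral_mono (integrable_mergedDensity m) (hint.add hW) fun x => ?_
        dsimp only
        rw [sum_pairDerivative_mergedCharge, mergedDensity]
        have := chargedWeight_nonneg (mergedCharge m) x
        nlinarith [mul_nonneg this (sq_nonneg (∑ i ∈ T, (x i - x 0)⁻¹))]
    _ = _ := by
        rw [integral_add hint hW, hsum, zero_add, integral_const_mul, integral_mergedWeight]

/-! ### Three close eigenvalues -/

/-- Particles `i` and `j` are adjacent, in this order and at distance less than `δ`, and a third
particle lies within `δ` of their midpoint. -/
def closeTriple {n : ℕ} (δ : ℝ) (i j : Fin n) : Set (Fin n → ℝ) :=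
  {x | x i ≤ x j ∧ x j - x i < δ ∧ (∀ l, x l ≤ x i ∨ x j ≤ x l) ∧
    ∃ k, k ≠ i ∧ k ≠ j ∧ |x k - (x i + x j) / 2| < δ}

theorem law_preimage_comp_perm {n : ℕ} (σ : Equiv.Perm (Fin n)) (s : Set (Fin n → ℝ)) :
    law n ((fun x => x ∘ σ) ⁻¹' s) = law n s := by
  rw [law, withDensity_apply', withDensity_apply',
    ← (measurePreserving_comp_perm σ).setLIntegral_comp_preimage_emb
      (measurableEmbedding_comp_perm σ)
      (fun x => ENNReal.ofReal ((partitionFunction n)⁻¹ * weight n x)) s]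
  simp only [weight_comp_perm]

theorem exists_perm_apply_zero_one {m : ℕ} {i j : Fin (m + 2)} (hij : i ≠ j) :
    ∃ σ : Equiv.Perm (Fin (m + 2)), σ 0 = i ∧ σ 1 = j := by
  have h01 : (0 : Fin (m + 2)) ≠ 1 := by simp
  refine ⟨(Equiv.swap 0 i).trans (Equiv.swap (Equiv.swap 0 i 1) j), ?_, ?_⟩
  · rw [Equiv.trans_apply, Equiv.swap_apply_left]
    refine Equiv.swap_apply_of_ne_of_ne ?_ hij
    intro h
    have := (Equiv.swap 0 i).injective ((Equiv.swap_apply_left 0 i).trans h)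
    exact h01 this
  · rw [Equiv.trans_apply, Equiv.swap_apply_left]

theorem law_closeTriple_eq {m : ℕ} (δ : ℝ) {i j : Fin (m + 2)} (hij : i ≠ j) :
    law (m + 2) (closeTriple δ i j) = law (m + 2) (closeTriple δ 0 1) := by
  obtain ⟨σ, h0, h1⟩ := exists_perm_apply_zero_one hij
  rw [← law_preimage_comp_perm σ (closeTriple δ 0 1)]
  congr 1
  ext x
  simp only [closeTriple, Set.mem_preimage, Set.mem_ofPred_eq, Function.comp_apply, h0, h1]
  refine and_congr_right fun _ => and_congr_right fun _ => and_congr ?_ ?_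
  · exact σ.forall_congr_right (q := fun l => x l ≤ x i ∨ x j ≤ x l) |>.symm
  · rw [← σ.exists_congr_right]
    simp only [← h0, ← h1, σ.injective.ne_iff]

/-- Replacing two adjacent particles by one of charge `2` at their midpoint increases the weight,
up to the factor `u` given by their distance: for every other position `a`, outside the interval
between them, the product of its distances to the two is at most the square of its distance to the
midpoint. -/
theorem weight_le_of_mem_closeTriple {m : ℕ} {δ : ℝ} {x : Fin (m + 2) → ℝ}
    (hx : x ∈ closeTriple δ 0 1) :
    weight (m + 2) x ≤ (x 1 - x 0) * (δ ^ 2 *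
      mergedDensity m (Fin.tail x - Pi.single 0 ((x 1 - x 0) / 2))) := by
  obtain ⟨h01, hlt, hadj, k, hk0, hk1, hk⟩ := hx
  obtain ⟨t, y, rfl⟩ : ∃ t y, x = (Fin.cons t y : Fin (m + 2) → ℝ) :=
    ⟨x 0, Fin.tail x, (Fin.cons_self_tail x).symm⟩
  obtain ⟨k, rfl⟩ := Fin.exists_succ_eq.2 hk0
  have hk1' : k ≠ 0 := fun h => hk1 (by simp [h])
  have e1 : (Fin.cons t y : Fin (m + 2) → ℝ) 1 = y 0 := rfl
  simp only [e1, Fin.cons_zero, Fin.cons_succ, Fin.tail_cons] at *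
  have hadj' (l : Fin (m + 1)) : y l ≤ t ∨ y 0 ≤ y l := by simpa using hadj l.succ
  set c : ℝ := (t + y 0) / 2
  set Y : Fin (m + 1) → ℝ := y - Pi.single 0 ((y 0 - t) / 2)
  have hY0 : Y 0 = c := by simp [Y, c]; ring
  have hYk {l : Fin (m + 1)} (hl : l ≠ 0) : Y l = y l := by simp [Y, hl]
  rcases h01.eq_or_lt with heq | hpos
  · have h0 : weight (m + 2) (Fin.cons t y : Fin (m + 2) → ℝ) = 0 :=
      weight_eq_zero_of_eq (i := 0) (j := 1) (by simp) heq
    rw [h0, heq, sub_self, zero_mul]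
  have hone : 1 ≤ δ ^ 2 * ∑ i ∈ Finset.univ.erase 0, (Y i - Y 0)⁻¹ ^ 2 := by
    have hne : y k - c ≠ 0 := by
      intro h
      rcases hadj' k with h' | h' <;> simp only [c] at h <;> linarith
    have hle : (Y k - Y 0)⁻¹ ^ 2 ≤ ∑ i ∈ Finset.univ.erase 0, (Y i - Y 0)⁻¹ ^ 2 :=
      Finset.single_le_sum (f := fun i => (Y i - Y 0)⁻¹ ^ 2) (fun _ _ => sq_nonneg _)
        (Finset.mem_erase.2 ⟨hk1', Finset.mem_univ k⟩)
    refine le_trans ?_ (mul_le_mul_of_nonneg_left hle (sq_nonneg δ))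
    rw [hY0, hYk hk1', inv_pow, ← div_eq_mul_inv, one_le_div (by positivity)]
    exact sq_le_sq.2 (hk.le.trans (le_abs_self δ))
  have hW : weight (m + 2) (Fin.cons t y : Fin (m + 2) → ℝ) ≤
      (y 0 - t) * chargedWeight (mergedCharge m) Y := by
    rw [weight_cons, weight_eq_mul_rest, mergedWeight_eq_mul_rest,
      ← Finset.mul_prod_erase _ _ (Finset.mem_univ (0 : Fin (m + 1))),
      chargedRest_congr (q := mergedCharge m) (q' := mergedCharge m) (x := Y) (x' := y)
        (fun _ _ => rfl) fun _ hl => hYk hl, hY0, abs_sub_comm t, abs_of_pos (sub_pos.2 hpos)]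
    have hexp : Real.exp (-(t ^ 2 / 2)) * Real.exp (-(y 0 ^ 2 / 2)) ≤ Real.exp (-(c ^ 2)) := by
      rw [← Real.exp_add]
      refine Real.exp_le_exp.2 ?_
      simp only [c]
      nlinarith [sq_nonneg (t - y 0)]
    have hprod : (∏ l ∈ Finset.univ.erase 0, |t - y l|) *
        (∏ l ∈ Finset.univ.erase 0, |y 0 - y l|) ≤
        ∏ l ∈ Finset.univ.erase 0, |c - Y l| ^ 2 := by
      rw [← Finset.prod_mul_distrib]
      refine Finset.prod_le_prod (fun l _ => by positivity) fun l hl => ?_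
      rw [hYk (Finset.ne_of_mem_erase hl), ← abs_mul, sq_abs, abs_of_nonneg]
      · simp only [c]
        nlinarith [sq_nonneg (t - y 0)]
      · rcases hadj' l with h | h
        · exact mul_nonneg (by linarith) (by linarith)
        · exact mul_nonneg_of_nonpos_of_nonpos (by linarith) (by linarith)
    calc _ = (y 0 - t) * ((Real.exp (-(t ^ 2 / 2)) * Real.exp (-(y 0 ^ 2 / 2))) *
          ((∏ l ∈ Finset.univ.erase 0, |t - y l|) * ∏ l ∈ Finset.univ.erase 0, |y 0 - y l|) *
          chargedRest (mergedCharge m) 0 y) := by ring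
      _ ≤ _ := by
        refine mul_le_mul_of_nonneg_left ?_ (sub_pos.2 hpos).le
        refine mul_le_mul_of_nonneg_right ?_ (chargedRest_nonneg _ _ _)
        exact mul_le_mul hexp hprod (mul_nonneg (Finset.prod_nonneg fun _ _ => abs_nonneg _)
          (Finset.prod_nonneg fun _ _ => abs_nonneg _)) (Real.exp_pos _).le
  refine hW.trans (mul_le_mul_of_nonneg_left ?_ (sub_pos.2 hpos).le)
  rw [mergedDensity, mul_left_comm]
  exact le_mul_of_one_le_right (chargedWeight_nonneg _ _) hone

theorem lintegral_eq_lintegral_cons {n : ℕ} {F : (Fin (n + 1) → ℝ) → ENNReal}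
    (hF : Measurable F) :
    ∫⁻ x, F x = ∫⁻ y : Fin n → ℝ, ∫⁻ t : ℝ, F (Fin.cons t y : Fin (n + 1) → ℝ) := by
  have hm := (volume_preserving_piFinSuccAbove (fun _ : Fin (n + 1) => ℝ) 0).symm
  rw [← hm.lintegral_comp hF]
  refine (lintegral_prod_symm _ (hF.comp hm.measurable).aemeasurable).trans ?_
  refine lintegral_congr fun y => lintegral_congr fun t => ?_
  exact congrArg F (Fin.insertNth_zero' t y)

theorem measurable_single_half (m : ℕ) :
    Measurable fun u : ℝ => (Pi.single 0 (u / 2) : Fin (m + 1) → ℝ) := by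
  refine measurable_pi_iff.2 fun k => ?_
  rcases eq_or_ne k 0 with rfl | hk
  · simpa using measurable_id.div_const 2
  · simp [hk]

theorem measurable_sub_mul_midpoint {m : ℕ} {g : ℝ → ENNReal} {h : (Fin (m + 1) → ℝ) → ENNReal}
    (hg : Measurable g) (hh : Measurable h) :
    Measurable fun x : Fin (m + 2) → ℝ =>
      g (x 1 - x 0) * h (Fin.tail x - Pi.single 0 ((x 1 - x 0) / 2)) := by
  have htail : Measurable (Fin.tail : (Fin (m + 2) → ℝ) → Fin (m + 1) → ℝ) :=
    measurable_pi_iff.2 fun k => measurable_pi_apply k.succ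
  have hdiff : Measurable fun x : Fin (m + 2) → ℝ => x 1 - x 0 := by fun_prop
  exact (hg.comp hdiff).mul (hh.comp (htail.sub ((measurable_single_half m).comp hdiff)))

/-- Change of variables from two particles to their difference and midpoint. -/
theorem lintegral_sub_mul_midpoint {m : ℕ} {g : ℝ → ENNReal} {h : (Fin (m + 1) → ℝ) → ENNReal}
    (hg : Measurable g) (hh : Measurable h) :
    ∫⁻ x : Fin (m + 2) → ℝ, g (x 1 - x 0) *
        h (Fin.tail x - Pi.single 0 ((x 1 - x 0) / 2)) = (∫⁻ u, g u) * ∫⁻ y, h y := by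
  rw [lintegral_eq_lintegral_cons (measurable_sub_mul_midpoint hg hh)]
  calc _ = ∫⁻ y : Fin (m + 1) → ℝ, ∫⁻ u, g u * h (y - Pi.single 0 (u / 2)) := by
        refine lintegral_congr fun y => ?_
        exact lintegral_sub_left_eq_self (μ := volume)
          (fun u : ℝ => g u * h (y - Pi.single 0 (u / 2))) (y 0)
    _ = ∫⁻ u, ∫⁻ y : Fin (m + 1) → ℝ, g u * h (y - Pi.single 0 (u / 2)) := by
        refine lintegral_lintegral_swap (Measurable.aemeasurable ?_)
        exact (hg.comp measurable_snd).mul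
          (hh.comp (measurable_fst.sub ((measurable_single_half m).comp measurable_snd)))
    _ = ∫⁻ u, g u * ∫⁻ y, h y := by
        refine lintegral_congr fun u => ?_
        have hy : Measurable fun y : Fin (m + 1) → ℝ => h (y - Pi.single 0 (u / 2)) :=
          hh.comp (measurable_id.sub_const _)
        rw [lintegral_const_mul _ hy, lintegral_sub_right_eq_self h]
    _ = _ := lintegral_mul_const _ hg

theorem lintegral_indicator_Ico_ofReal {δ : ℝ} (hδ : 0 ≤ δ) :
    ∫⁻ u, (Set.Ico 0 δ).indicator ENNReal.ofReal u = ENNReal.ofReal (δ ^ 2 / 2) := by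
  have hi : IntegrableOn (fun u : ℝ => u) (Set.Ico 0 δ) :=
    continuous_id.integrableOn_Icc.mono_set Set.Ico_subset_Icc_self
  rw [lintegral_indicator measurableSet_Ico, ← ofReal_integral_eq_lintegral_ofReal hi
    ((ae_restrict_mem measurableSet_Ico).mono fun u hu => hu.1),
    integral_Ico_eq_integral_Ioc, ← intervalIntegral.integral_of_le hδ, integral_id]
  simp

theorem lintegral_mergedDensity_le (m : ℕ) (δ : ℝ) :
    ∫⁻ y, ENNReal.ofReal ((partitionFunction (m + 2))⁻¹ * (δ ^ 2 * mergedDensity m y)) ≤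
      ENNReal.ofReal (δ ^ 2 * m / 4) := by
  have hG := partitionFunction_pos (m + 2)
  rw [← ofReal_integral_eq_lintegral_ofReal
    (((integrable_mergedDensity m).const_mul _).const_mul _)
    (Eventually.of_forall fun y => mul_nonneg (inv_nonneg.2 hG.le)
      (mul_nonneg (sq_nonneg δ) (mergedDensity_nonneg m y))),
    integral_const_mul, integral_const_mul]
  refine ENNReal.ofReal_le_ofReal ?_
  calc _ ≤ (partitionFunction (m + 2))⁻¹ * (δ ^ 2 * (m * (partitionFunction (m + 2) / 4))) := by
        refine mul_le_mul_of_nonneg_left ?_ (inv_nonneg.2 hG.le)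
        exact mul_le_mul_of_nonneg_left (integral_mergedDensity_le m) (sq_nonneg δ)
    _ = _ := by field_simp

theorem law_closeTriple_le (m : ℕ) {δ : ℝ} (hδ : 0 ≤ δ) {i j : Fin (m + 2)} (hij : i ≠ j) :
    law (m + 2) (closeTriple δ i j) ≤ ENNReal.ofReal (δ ^ 4 * m / 8) := by
  rw [law_closeTriple_eq δ hij]
  obtain ⟨g, hg'⟩ : ∃ g : ℝ → ENNReal, g = (Set.Ico 0 δ).indicator ENNReal.ofReal := ⟨_, rfl⟩
  obtain ⟨h, hh'⟩ : ∃ h : (Fin (m + 1) → ℝ) → ENNReal, h = fun y =>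
    ENNReal.ofReal ((partitionFunction (m + 2))⁻¹ * (δ ^ 2 * mergedDensity m y)) := ⟨_, rfl⟩
  have hg : Measurable g := hg' ▸ ENNReal.measurable_ofReal.indicator measurableSet_Ico
  have hh : Measurable h := hh' ▸
    (((measurable_mergedDensity m).const_mul _).const_mul _).ennreal_ofReal
  have hle {x : Fin (m + 2) → ℝ} (hx : x ∈ closeTriple δ 0 1) :
      ENNReal.ofReal ((partitionFunction (m + 2))⁻¹ * weight (m + 2) x) ≤
        g (x 1 - x 0) * h (Fin.tail x - Pi.single 0 ((x 1 - x 0) / 2)) := by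
    have hmem : x 1 - x 0 ∈ Set.Ico 0 δ := ⟨sub_nonneg.2 hx.1, hx.2.1⟩
    rw [hg', hh', Set.indicator_of_mem hmem, ← ENNReal.ofReal_mul hmem.1, mul_left_comm]
    exact ENNReal.ofReal_le_ofReal (mul_le_mul_of_nonneg_left (weight_le_of_mem_closeTriple hx)
      (inv_nonneg.2 (partitionFunction_pos _).le))
  rw [law, withDensity_apply']
  calc _ ≤ ∫⁻ x in closeTriple δ 0 1, g (x 1 - x 0) *
          h (Fin.tail x - Pi.single 0 ((x 1 - x 0) / 2)) :=
        setLIntegral_mono (measurable_sub_mul_midpoint hg hh) fun x hx => hle hx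
    _ ≤ ∫⁻ x : Fin (m + 2) → ℝ, g (x 1 - x 0) *
          h (Fin.tail x - Pi.single 0 ((x 1 - x 0) / 2)) := setLIntegral_le_lintegral _ _
    _ = (∫⁻ u, g u) * ∫⁻ y, h y := lintegral_sub_mul_midpoint hg hh
    _ ≤ ENNReal.ofReal (δ ^ 2 / 2) * ENNReal.ofReal (δ ^ 2 * m / 4) := by
        rw [hg', hh', lintegral_indicator_Ico_ofReal hδ]
        exact mul_le_mul_right (lintegral_mergedDensity_le m δ) _
    _ = _ := by
        rw [← ENNReal.ofReal_mul (by positivity)]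
        congr 1
        ring

/-! ### The point processes of gaps -/

theorem ordered_monotone {n : ℕ} (x : Fin n → ℝ) : Monotone (ordered x) :=
  Tuple.monotone_sort x

theorem neighbourGaps_pos_iff {n j : ℕ} {x : Fin n → ℝ} {A : Set ℝ} (hA : MeasurableSet A) :
    0 < neighbourGaps n j x A ↔
      ∃ a b : Fin n, (a : ℕ) + j = b ∧ (n : ℝ) * (ordered x b - ordered x a) ∈ A := by
  rw [neighbourGaps, Measure.finsetSum_apply, pos_iff_ne_zero, Ne, Finset.sum_eq_zero_iff]
  simp [Measure.dirac_apply' _ hA]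

theorem mem_closeTriple_of_neighbourGaps_pos {n : ℕ} {c : ℝ} {x : Fin n → ℝ}
    (h : 0 < neighbourGaps n 2 x (Set.Ioo 0 c)) :
    ∃ i j : Fin n, i ≠ j ∧ x ∈ closeTriple (c / n) i j := by
  obtain ⟨a, b, hab, hpos, hlt⟩ := (neighbourGaps_pos_iff measurableSet_Ioo).1 h
  have hn : (0 : ℝ) < n := by exact_mod_cast Fin.pos a
  have hd : ordered x b - ordered x a < c / n := by rwa [lt_div_iff₀ hn, mul_comm]
  obtain ⟨s, hs⟩ : ∃ s : Fin n, (s : ℕ) = a + 1 := ⟨⟨a + 1, by omega⟩, rfl⟩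
  have has : ordered x a ≤ ordered x s := ordered_monotone x (Fin.le_def.2 (by omega))
  have hsb : ordered x s ≤ ordered x b := ordered_monotone x (Fin.le_def.2 (by omega))
  have hinj := (Tuple.sort x).injective
  have ne1 : a ≠ s := fun h' => by rw [h'] at hs; omega
  have ne2 : b ≠ a := fun h' => by rw [h'] at hab; omega
  have ne3 : b ≠ s := fun h' => by rw [h'] at hab; omega
  refine ⟨Tuple.sort x a, Tuple.sort x s, hinj.ne ne1, has, ?_, fun l => ?_, Tuple.sort x b,
    hinj.ne ne2, hinj.ne ne3, ?_⟩
  · change ordered x s - ordered x a < _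
    linarith
  · obtain ⟨l, rfl⟩ := (Tuple.sort x).surjective l
    rcases le_or_gt l a with hl | hl
    · exact Or.inl (ordered_monotone x hl)
    · exact Or.inr (ordered_monotone x (Fin.le_def.2 (by rw [hs]; exact hl)))
  · change |ordered x b - (ordered x a + ordered x s) / 2| < _
    rw [abs_of_nonneg] <;> linarith

theorem law_neighbourGaps_two_pos_le {c : ℝ} {n : ℕ} (hn : 2 * c ^ 2 + 2 < (n : ℝ)) :
    (law n).real {x | 0 < neighbourGaps n 2 x (Set.Ioo 0 c)} ≤ c ^ 4 / (8 * n) := by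
  have hn2 : 2 < n := by
    have : (2 : ℝ) < n := by nlinarith [sq_nonneg c]
    exact_mod_cast this
  obtain ⟨m, rfl⟩ : ∃ m, n = m + 2 := ⟨n - 2, by omega⟩
  rcases le_or_gt c 0 with hc | hc
  · simp only [Set.Ioo_eq_empty_of_le hc, measure_empty, lt_irrefl, Set.ofPred_false,
      measureReal_empty]
    positivity
  set N : ℝ := ((m + 2 : ℕ) : ℝ)
  have hN : 0 < N := by simp only [N]; positivity
  refine ENNReal.toReal_le_of_le_ofReal (by positivity) ?_
  calc law (m + 2) {x | 0 < neighbourGaps (m + 2) 2 x (Set.Ioo 0 c)}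
      ≤ law (m + 2) (⋃ p ∈ (Finset.univ : Finset (Fin (m + 2))).offDiag,
          closeTriple (c / N) p.1 p.2) := by
        refine measure_mono fun x hx => ?_
        obtain ⟨i, j, hij, h⟩ := mem_closeTriple_of_neighbourGaps_pos hx
        exact Set.mem_biUnion (x := (i, j)) (by simpa using hij) h
    _ ≤ ∑ p ∈ (Finset.univ : Finset (Fin (m + 2))).offDiag,
          law (m + 2) (closeTriple (c / N) p.1 p.2) := measure_biUnion_finset_le _ _
    _ ≤ ∑ p ∈ (Finset.univ : Finset (Fin (m + 2))).offDiag,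
          ENNReal.ofReal ((c / N) ^ 4 * m / 8) :=
        Finset.sum_le_sum fun p hp => law_closeTriple_le m (by positivity) (by simpa using hp)
    _ ≤ ∑ p : Fin (m + 2) × Fin (m + 2), ENNReal.ofReal ((c / N) ^ 4 * m / 8) :=
        Finset.sum_le_sum_of_subset (Finset.subset_univ _)
    _ = ENNReal.ofReal (N ^ 2 * ((c / N) ^ 4 * m / 8)) := by
        rw [Finset.sum_const, nsmul_eq_mul, ENNReal.ofReal_mul (by positivity)]
        congr 1
        rw [Finset.card_univ, Fintype.card_prod, Fintype.card_fin, ← ENNReal.ofReal_natCast]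
        congr 1
        simp only [N]
        push_cast
        ring
    _ ≤ _ := by
        refine ENNReal.ofReal_le_ofReal ?_
        have hm : (m : ℝ) ≤ N := by simp [N]
        calc N ^ 2 * ((c / N) ^ 4 * m / 8) ≤ N ^ 2 * ((c / N) ^ 4 * N / 8) := by gcongr
          _ = c ^ 4 / (8 * N) := by field_simp

theorem law_weight_eq_zero (n : ℕ) : law n {x | weight n x = 0} = 0 := by
  rw [law, withDensity_apply']
  refine (setLIntegral_congr_fun (g := fun _ => 0)
    ((continuous_weight n).measurable (measurableSet_singleton 0)) fun x hx => ?_).trans (by simp)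
  have : weight n x = 0 := hx
  simp [this]

theorem pairGaps_eq_sum_ordered {n : ℕ} (x : Fin n → ℝ) :
    pairGaps n x = ∑ p : Fin n × Fin n with p.1 < p.2,
      Measure.dirac ((n : ℝ) * (ordered x p.2 - ordered x p.1)) := by
  rw [pairGaps, ← sum_pairs_comp_perm (fun a b => Measure.dirac ((n : ℝ) * |x a - x b|))
    (fun a b => by rw [abs_sub_comm]) (Tuple.sort x)]
  refine Finset.sum_congr rfl fun p hp => ?_
  have hlt : p.1 < p.2 := by simpa using hp
  have := ordered_monotone x hlt.le
  change Measure.dirac ((n : ℝ) * |ordered x p.1 - ordered x p.2|) = _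
  rw [abs_sub_comm, abs_of_nonneg (sub_nonneg.2 this)]

/-- Away from coinciding eigenvalues, the two processes can only differ on `A` through two
eigenvalues that are not consecutive, and these enclose a small second-neighbour gap. -/
theorem gaps_eq_pairGaps {n : ℕ} {x : Fin n → ℝ} {A : Set ℝ} {c : ℝ} (hA : MeasurableSet A)
    (hAc : ∀ a ∈ A, a < c) (hw : weight n x ≠ 0)
    (h : ¬ 0 < neighbourGaps n 2 x (Set.Ioo 0 c)) : gaps n x A = pairGaps n x A := by
  have hinj : Function.Injective x := fun i j hij =>
    by_contra fun hne => hw (weight_eq_zero_of_eq hne hij)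
  have hmono : StrictMono (ordered x) :=
    (ordered_monotone x).strictMono_of_injective (hinj.comp (Tuple.sort x).injective)
  rw [neighbourGaps_pos_iff measurableSet_Ioo] at h
  rw [pairGaps_eq_sum_ordered, gaps, neighbourGaps, Measure.finsetSum_apply,
    Measure.finsetSum_apply]
  refine Finset.sum_subset (fun p hp => ?_) fun p hp hp' => ?_
  · simp only [Finset.mem_filter, Finset.mem_univ, true_and] at hp ⊢
    exact Fin.lt_def.2 (by omega)
  · simp only [Finset.mem_filter, Finset.mem_univ, true_and] at hp hp'
    have hn : (0 : ℝ) < n := by exact_mod_cast Fin.pos p.1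
    have hlt := Fin.lt_def.1 hp
    obtain ⟨s, hs⟩ : ∃ s : Fin n, (p.1 : ℕ) + 2 = s := ⟨⟨p.1 + 2, by omega⟩, rfl⟩
    have h1 : ordered x p.1 < ordered x s := hmono (Fin.lt_def.2 (by omega))
    have h2 : ordered x s ≤ ordered x p.2 := ordered_monotone x (Fin.le_def.2 (by omega))
    have h3 : c ≤ n * (ordered x s - ordered x p.1) := by
      by_contra hlt'
      exact h ⟨p.1, s, hs, mul_pos hn (sub_pos.2 h1), not_le.1 hlt'⟩
    have h4 : c ≤ n * (ordered x p.2 - ordered x p.1) :=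
      h3.trans (mul_le_mul_of_nonneg_left (by linarith) hn.le)
    rw [Measure.dirac_apply' _ hA, Set.indicator_of_notMem]
    exact fun hmem => (hAc _ hmem).not_ge h4

theorem tendsto_law_gaps_sub_pairGaps {A : Set ℝ} (hA : MeasurableSet A)
    (hb : Bornology.IsBounded A) {ε : ℝ} (hε : 0 < ε) :
    Tendsto (fun n : ℕ => (law n).real {x | ε ≤ |(gaps n x).real A - (pairGaps n x).real A|})
      atTop (𝓝 0) := by
  obtain ⟨C, hC⟩ := isBounded_iff_forall_norm_le.1 hb
  set c : ℝ := C + 1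
  have hAc : ∀ a ∈ A, a < c := fun a ha =>
    ((le_abs_self a).trans (hC a ha)).trans_lt (lt_add_one C)
  have hlim : Tendsto (fun n : ℕ => c ^ 4 / (8 * (n : ℝ))) atTop (𝓝 0) :=
    tendsto_const_nhds.div_atTop
      (tendsto_natCast_atTop_atTop.const_mul_atTop (by norm_num))
  refine squeeze_zero' (Eventually.of_forall fun n => measureReal_nonneg) ?_ hlim
  filter_upwards [tendsto_natCast_atTop_atTop.eventually_gt_atTop (2 * c ^ 2 + 2)] with n hn
  refine le_trans ?_ (law_neighbourGaps_two_pos_le hn)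
  have hsub : {x | ε ≤ |(gaps n x).real A - (pairGaps n x).real A|} ⊆
      {x | 0 < neighbourGaps n 2 x (Set.Ioo 0 c)} ∪ {x | weight n x = 0} := by
    intro x hx
    by_contra hnot
    simp only [Set.mem_union, Set.mem_ofPred_eq, not_or] at hnot hx
    rw [measureReal_def, measureReal_def, gaps_eq_pairGaps hA hAc hnot.2 hnot.1, sub_self,
      abs_zero] at hx
    linarith
  refine (measureReal_mono hsub).trans ((measureReal_union_le _ _).trans_eq ?_)
  rw [measureReal_def (law n) {x | weight n x = 0}, law_weight_eq_zero, ENNReal.toReal_zero,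
    add_zero]

end GOE

theorem mainTheorem4 :
    (∀ (c₀ : ℝ) (n : ℕ), 2 * c₀ ^ 2 + 2 < (n : ℝ) →
      (GOE.law n).real {x | 0 < GOE.neighbourGaps n 2 x (Set.Ioo 0 c₀)} ≤ c₀ ^ 4 / (8 * n)) ∧
    (∀ A : Set ℝ, A ⊆ Set.Ici 0 → A.OrdConnected → Bornology.IsBounded A →
      ∀ ε : ℝ, 0 < ε →
        Tendsto
          (fun n : ℕ =>
            (GOE.law n).real {x | ε ≤ |(GOE.gaps n x).real A - (GOE.pairGaps n x).real A|})
          atTop (𝓝 0)) :=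
  ⟨fun _ _ hn => GOE.law_neighbourGaps_two_pos_le hn, fun _ _ hA hb _ hε =>
    GOE.tendsto_law_gaps_sub_pairGaps hA.measurableSet hb hε⟩
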